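/- Let $p,q,r$ be pairwise relatively prime positive integers with $\frac1p+\frac1q+\frac1r<1$, let $\frac1s=1-\frac1p-\frac1q-\frac1r$, and let $v_1,v_2,v_3\in\mathbb H$ be the vertices, in counterclockwise order, of a hyperbolic triangle with interior angles $\pi/p,\pi/q,\pi/r$. Let $\Delta<PSL(2,\mathbb R)$ be the group of orientation-preserving elements of the group generated by the reflections in the sides of this triangle, let $\widetilde\Delta$ be its preimage in the universal covering group $\widetilde{SL}$ of $PSL(2,\mathbb R)$, and let $\Pi=[\widetilde\Delta,\widetilde\Delta]$. Regard $\widetilde{SL}$ as the group of pairs $(g,\ell)$ of a biholomorphic map $g:\mathbb H\to\mathbb H$ and a continuous $\ell:\mathbb H\to\mathbb C$ with $e^{i\ell}=g'$, acting on $\mathbb H\times\mathbb C$ by $(z,w)\mapsto(g(z),w+\ell(z))$. This action preserves the image of $\mathbb H\times\mathbb R$ under the embedding $j(z,t)=(z,t-i\log \operatorname{Im} z)$, so $\widetilde{SL}$ acts on $\mathbb H\times\mathbb R$; on $\mathbb H\times\mathbb R$, with coordinates $(x+iy,t)$, the contact form $\lambda=dt+\frac1y\,dx$ and the frame $$e_1=(y\cos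 t,\,y\sin t,\,-\cos t),\qquad e_2=(-y\sin t,\,y\cos t,\,\sin t)$$ of $\ker\lambda$ are $\widetilde{SL}$-invariant. The Brieskorn manifold $\Sigma(p,q,r)$ is identified with the quotient $\Pi\backslash(\mathbb H\times\mathbb R)$. Let $\phi_1(z,w)=F(z)e^{iaw}$, with $a=s/p$ and $F$ holomorphic on $\mathbb H$, be a $\Pi$-invariant function on $\mathbb H\times\mathbb C$ (an automorphic form of degree $s/p$) such that $F$ has a simple zero at every point of the orbit $\Delta v_1$. For $\epsilon>0$ put $f=1+\epsilon|\phi_1\circ j|^2$. Let $\gamma_1(t)=[(v_1,t)]\in\Sigma(p,q,r)$ be the exceptional fibre over $v_1$, with period $2\pi\frac{qr}{s}$, and let $\gamma_1^n$ be its $n$-th iterate, of period $2\pi\frac{qr}{s}n$. Then for every integer $N>0$ there is $\epsilon_0>0$ such that for all $0<\epsilon<\epsilon_0$: $f\lambda$ descends to a (positive) contact form on $\Sigma(p,q,r)$, and for each $n=1,\dots,N$ the curve $\gamma_1^n$ is a nondegenerate elliptic Reeb orbit of $f\lambda$ (that is, $1$ is not an eigenvalue of the linearized return map on the contact plane, and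 the eigenvalues of this map lie on the unit circle). Moreover its Conley–Zehnder index with respect to the trivialization $\tau$ of the contact structure induced by $(e_1,e_2)$ is $$CZ_\tau(\gamma_1^n)=-2\left\lfloor n\tfrac{qr}{s}\right\rfloor-1 .$$ Here, for an elliptic orbit, $CZ_\tau=2\lfloor\theta\rfloor+1$, where $2\pi\theta$ is the total angle of the linearized Reeb flow along the orbit once a homotopy of $\tau$ has turned it into a path of rotations starting at angle $0$; for an orbit whose return map has a real eigenvector, $CZ_\tau=k$, where $k\pi$ is the total angle through which the linearized flow rotates this eigenvector. -/

import Mathlib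

open UpperHalfPlane
open scoped MatrixGroups ContDiff Topology

noncomputable section

namespace Brieskorn

/-! ## Labeled biholomorphic maps and triangle groups

A point of the universal cover of `ℂ^×` is written through its logarithmic coordinate `w : ℂ`,
which lies over `exp (I * w)`. So `ℍ × ℂ` stands for `ℍ` times the universal cover of `ℂ^×`. -/

/-- The chain rule for the derivatives of Moebius transformations. -/
lemma deriv_moebius_mul (A B : SL(2, ℝ)) (z : ℍ) :
    deriv (fun x : ℂ => (((A * B) • ofComplex x : ℍ) : ℂ)) z =
      deriv (fun x : ℂ => ((A • ofComplex x : ℍ) : ℂ)) ((B • z : ℍ) : ℂ) *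
        deriv (fun x : ℂ => ((B • ofComplex x : ℍ) : ℂ)) z := by
  have key : ∀ (C : SL(2, ℝ)) (w : ℍ), HasDerivAt (fun x : ℂ => ((C • ofComplex x : ℍ) : ℂ))
      (deriv (fun x : ℂ => ((C • ofComplex x : ℍ) : ℂ)) w) w := by
    intro C w
    have h : 0 < (Matrix.SpecialLinearGroup.mapGL ℝ C : GL (Fin 2) ℝ).val.det := by simp
    exact (hasStrictDerivAt_smul h w).hasDerivAt.differentiableAt.hasDerivAt
  have hA := key A (B • z)
  have hB := key B z
  have hA' : HasDerivAt (fun x : ℂ => ((A • ofComplex x : ℍ) : ℂ))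
      (deriv (fun x : ℂ => ((A • ofComplex x : ℍ) : ℂ)) ((B • z : ℍ) : ℂ))
      ((fun x : ℂ => ((B • ofComplex x : ℍ) : ℂ)) z) := by
    simpa using hA
  have h := (hA'.comp (z : ℂ) hB).deriv
  rw [← h]
  congr 1
  funext x
  simp [mul_smul]

/-- The group of labeled biholomorphic maps of the upper half-plane whose underlying Moebius
transformation lies in `S`, as permutations of `ℍ × ℂ`. A labeled map is a Moebius
transformation `A` together with a continuous lift `ℓ` of its derivative through
`w ↦ exp (I * w)`; it acts by `(z, w) ↦ (A z, w + ℓ z)`. For `S = ⊤` this is the universal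
covering group of `PSL(2, ℝ)`; in general it is the preimage of (the image of) `S`. -/
def labeledLift (S : Subgroup SL(2, ℝ)) : Subgroup (Equiv.Perm (ℍ × ℂ)) where
  carrier := {g | ∃ A ∈ S, ∃ ℓ : ℍ → ℂ, Continuous ℓ ∧
    (∀ z : ℍ, Complex.exp (Complex.I * ℓ z) = deriv (fun x : ℂ => ((A • ofComplex x : ℍ) : ℂ)) z) ∧
    ∀ z w, g (z, w) = (A • z, w + ℓ z)}
  mul_mem' := by
    rintro g h ⟨A, hA, ℓ, hℓ, hd, hg⟩ ⟨B, hB, k, hk, hd', hh⟩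
    refine ⟨A * B, S.mul_mem hA hB, fun z => ℓ (B • z) + k z,
      (hℓ.comp (continuous_const_smul B)).add hk, fun z => ?_, fun z w => ?_⟩
    · rw [deriv_moebius_mul, mul_add, Complex.exp_add, hd, hd']
    · rw [Equiv.Perm.mul_apply, hh, hg, mul_smul]
      congr 1
      ring
  one_mem' := by
    refine ⟨1, S.one_mem, fun _ => 0, continuous_const, fun z => ?_, fun z w => by simp⟩
    have h : (fun x : ℂ => (((1 : SL(2, ℝ)) • ofComplex x : ℍ) : ℂ)) =ᶠ[𝓝 (z : ℂ)] id := by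
      simpa using! eventuallyEq_coe_comp_ofComplex z.im_pos
    rw [h.deriv_eq]
    simp
  inv_mem' := by
    rintro g ⟨A, hA, ℓ, hℓ, hd, hg⟩
    have hgi : ∀ z w, g⁻¹ (z, w) = (A⁻¹ • z, w + -ℓ (A⁻¹ • z)) := by
      intro z w
      rw [Equiv.Perm.inv_eq_iff_eq, hg]
      simp
    refine ⟨A⁻¹, S.inv_mem hA, fun z => -ℓ (A⁻¹ • z),
      (hℓ.comp (continuous_const_smul A⁻¹)).neg, fun z => ?_, hgi⟩
    have h := deriv_moebius_mul A A⁻¹ z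
    have h1 : (fun x : ℂ => (((A * A⁻¹) • ofComplex x : ℍ) : ℂ)) =ᶠ[𝓝 (z : ℂ)] id := by
      simpa using! eventuallyEq_coe_comp_ofComplex z.im_pos
    rw [h1.deriv_eq, ← hd] at h
    simp only [deriv_id] at h
    rw [mul_neg, Complex.exp_neg]
    exact (eq_inv_of_mul_eq_one_right h.symm).symm

/-- The universal covering group of `PSL(2, ℝ)`. -/
def SLTilde : Subgroup (Equiv.Perm (ℍ × ℂ)) := labeledLift ⊤

/-- The image of `a` under the conformal map `x ↦ (x - v) / (x - conj v)` onto the unit disc, which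
takes `v` to `0` and the geodesic rays from `v` to the radii. -/
def toDisc (v a : ℍ) : ℂ := ((a : ℂ) - v) / ((a : ℂ) - (starRingEnd ℂ) (v : ℂ))

/-- The oriented angle at `v`, in `(-π, π]`, from the geodesic ray through `a` to the geodesic ray
through `b`. -/
def orientedAngle (v a b : ℍ) : ℝ := Complex.arg (toDisc v b / toDisc v a)

/-- `v₁, v₂, v₃` are, in counterclockwise order, the vertices of a hyperbolic triangle with interior
angles `π / p`, `π / q`, `π / r`. -/
structure IsTriangle (p q r : ℕ) (v₁ v₂ v₃ : ℍ) : Prop where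
  angle₁ : orientedAngle v₁ v₂ v₃ = Real.pi / p
  angle₂ : orientedAngle v₂ v₃ v₁ = Real.pi / q
  angle₃ : orientedAngle v₃ v₁ v₂ = Real.pi / r

/-- `σ` acts on `ℍ` as the hyperbolic reflection in the geodesic through the points `a ≠ b`: a
matrix of determinant `-1` acts as an orientation-reversing isometry, and the reflection is the only
one that fixes both points. -/
def IsReflection (a b : ℍ) (σ : GL (Fin 2) ℝ) : Prop :=
  σ.val.det = -1 ∧ σ • a = a ∧ σ • b = b

/-- The group generated by the reflections in the three sides (together with `-1`, which acts
trivially on `ℍ`). -/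
def fullTriangleGroup (v₁ v₂ v₃ : ℍ) : Subgroup (GL (Fin 2) ℝ) :=
  Subgroup.closure {σ | IsReflection v₂ v₃ σ ∨ IsReflection v₃ v₁ σ ∨ IsReflection v₁ v₂ σ}

/-- The triangle group `Δ`: the orientation-preserving elements of the full triangle group (more
precisely, their preimage in `SL(2, ℝ)`). -/
def triangleGroup (v₁ v₂ v₃ : ℍ) : Subgroup SL(2, ℝ) :=
  (fullTriangleGroup v₁ v₂ v₃).comap Matrix.SpecialLinearGroup.toGL

/-- The centrally extended triangle group: the preimage of `Δ` in the universal covering group. -/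
def extendedTriangleGroup (v₁ v₂ v₃ : ℍ) : Subgroup (Equiv.Perm (ℍ × ℂ)) :=
  labeledLift (triangleGroup v₁ v₂ v₃)

/-- The commutator subgroup `Π` of the centrally extended triangle group. -/
def piGroup (v₁ v₂ v₃ : ℍ) : Subgroup (Equiv.Perm (ℍ × ℂ)) :=
  ⁅extendedTriangleGroup v₁ v₂ v₃, extendedTriangleGroup v₁ v₂ v₃⁆

/-! ## Automorphic forms -/

/-- The differential of degree `a` with coefficient function `F`, `(z, u) ↦ F z * u ^ a`. -/
def differential (a : ℚ) (F : ℍ → ℂ) (x : ℍ × ℂ) : ℂ :=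
  F x.1 * Complex.exp (Complex.I * a * x.2)

/-- The differential of degree `a` with coefficient `F` is a `Γ`-automorphic form. -/
structure IsAutomorphicForm (Γ : Subgroup (Equiv.Perm (ℍ × ℂ))) (a : ℚ) (F : ℍ → ℂ) : Prop where
  holomorphic : DifferentiableOn ℂ (F ∘ ofComplex) {z | 0 < z.im}
  invariant : ∀ g ∈ Γ, ∀ x, differential a F (g x) = differential a F x

/-- `F` has a simple zero at `z`. -/
def HasSimpleZero (F : ℍ → ℂ) (z : ℍ) : Prop :=
  F z = 0 ∧ deriv (F ∘ ofComplex) z ≠ 0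

/-! ## The lifted unit tangent bundle `ℍ × ℝ` and its quotients -/

/-- The identification of `ℍ × ℝ` with the lifted unit tangent bundle inside `ℍ × ℂ`: the unit
vector of angle `t` at `z` is `z.im * exp (I * t) = exp (I * (t - I * log z.im))`. -/
def unitTangent (m : ℍ × ℝ) : ℍ × ℂ := (m.1, m.2 - Complex.I * Real.log m.1.im)

/-- The quotient `Γ \ (ℍ × ℝ)`, where `Γ` acts through `unitTangent`. -/
def QuotSpace (Γ : Subgroup (Equiv.Perm (ℍ × ℂ))) : Type :=
  Quotient ((MulAction.orbitRel Γ (ℍ × ℂ)).comap unitTangent)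

/-- The projection `ℍ × ℝ → Γ \ (ℍ × ℝ)`. -/
def proj (Γ : Subgroup (Equiv.Perm (ℍ × ℂ))) (m : ℍ × ℝ) : QuotSpace Γ :=
  Quotient.mk ((MulAction.orbitRel Γ (ℍ × ℂ)).comap unitTangent) m

/-- The ambient vector space of `ℍ × ℝ`; the tangent space at every point. -/
abbrev E : Type := ℂ × ℝ

/-- `ℍ × ℝ` as an open subset of `ℂ × ℝ`. -/
def halfSpace : Set E := {m | 0 < m.1.im}

/-- The inclusion of `ℍ × ℝ` into `ℂ × ℝ`. -/
def coord (m : ℍ × ℝ) : E := ((m.1 : ℂ), m.2)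

/-- The action of `g` on `ℍ × ℝ` in coordinates (meaningful on `halfSpace`, for `g` in the
universal covering group): `unitTangent` intertwines it with the action of `g` on `ℍ × ℂ`. -/
def actCoord (g : Equiv.Perm (ℍ × ℂ)) (m : E) : E :=
  let x := g (unitTangent (ofComplex m.1, m.2))
  ((x.1 : ℂ), x.2.re)

/-! ## One-forms, contact forms and Reeb orbits

The projection `ℍ × ℝ → Γ \ (ℍ × ℝ)` is a covering map, and forms, vector fields, flows and frames
on the quotient are handled through their lifts to `ℍ × ℝ`. -/

/-- Exterior derivative of a one-form on an open subset of `E`. -/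
def dForm (α : E → E →L[ℝ] ℝ) (m v w : E) : ℝ := fderiv ℝ α m v w - fderiv ℝ α m w v

/-- `α` descends to a positive contact form on `Γ \ (ℍ × ℝ)`: it is smooth and `Γ`-invariant, and
`α ∧ dα` is positive on the basis `∂x, ∂y, ∂t`. -/
structure IsContactForm (Γ : Subgroup (Equiv.Perm (ℍ × ℂ))) (α : E → E →L[ℝ] ℝ) : Prop where
  smooth : ContDiffOn ℝ ∞ α halfSpace
  invariant : ∀ g ∈ Γ, ∀ m ∈ halfSpace,
    (α (actCoord g m)).comp (fderiv ℝ (actCoord g) m) = α m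
  contact : ∀ m ∈ halfSpace,
    0 < α m (1, 0) * dForm α m (Complex.I, 0) (0, 1)
      + α m (Complex.I, 0) * dForm α m (0, 1) (1, 0)
      + α m (0, 1) * dForm α m (1, 0) (Complex.I, 0)

/-- `v` is the value at `m` of the Reeb vector field of `α`. -/
def IsReebVector (α : E → E →L[ℝ] ℝ) (m v : E) : Prop :=
  α m v = 1 ∧ ∀ w, dForm α m v w = 0

/-- `c` is an integral curve, defined for all times, of the Reeb vector field of `α`. -/
def IsReebTrajectory (α : E → E →L[ℝ] ℝ) (c : ℝ → ℍ × ℝ) : Prop :=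
  ∀ t, ∃ R, IsReebVector α (coord (c t)) R ∧ HasDerivAt (fun u => coord (c u)) R t

/-- `c` is a Reeb trajectory that lifts the curve `γ`. -/
def IsReebLift (Γ : Subgroup (Equiv.Perm (ℍ × ℂ))) (α : E → E →L[ℝ] ℝ) (γ : ℝ → QuotSpace Γ)
    (c : ℝ → ℍ × ℝ) : Prop :=
  IsReebTrajectory α c ∧ ∀ t, γ t = proj Γ (c t)

/-- A Reeb orbit of period `T` (not necessarily the minimal one) in `Γ \ (ℍ × ℝ)`: a map from
`ℝ / Tℤ`, written as a `T`-periodic map on `ℝ`, that solves `γ' = R ∘ γ`. The `n`-th iterate of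
the Reeb orbit `γ` of period `T` is the same map `γ`, taken with the period `n * T`. -/
structure IsReebOrbit (Γ : Subgroup (Equiv.Perm (ℍ × ℂ))) (α : E → E →L[ℝ] ℝ) (γ : ℝ → QuotSpace Γ)
    (T : ℝ) : Prop where
  pos : 0 < T
  periodic : Function.Periodic γ T
  reeb : ∃ c, IsReebLift Γ α γ c

/-- `ψ` is the Reeb flow of `α` for times in `[0, T]`, on a neighbourhood of the point `m`. -/
def IsReebFlowNear (α : E → E →L[ℝ] ℝ) (m : E) (T : ℝ) (ψ : ℝ → E → E) : Prop :=
  ∃ U ∈ 𝓝 m, ∀ x ∈ U, ψ 0 x = x ∧ ∀ t ∈ Set.Icc 0 T, ψ t x ∈ halfSpace ∧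
    ∃ R, IsReebVector α (ψ t x) R ∧ HasDerivWithinAt (fun u => ψ u x) R (Set.Icc 0 T) t

/-- `D t` is the derivative at `m` of the time `t` map of the Reeb flow, for `t ∈ [0, T]`. -/
def IsLinearizedFlow (α : E → E →L[ℝ] ℝ) (m : E) (T : ℝ) (D : ℝ → E →L[ℝ] E) : Prop :=
  ∃ ψ, IsReebFlowNear α m T ψ ∧ ∀ t ∈ Set.Icc 0 T, HasFDerivAt (ψ t) (D t) m

/-- The contact plane of `α` at `m`. -/
abbrev contactPlane (α : E → E →L[ℝ] ℝ) (m : E) : Submodule ℝ E :=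
  LinearMap.ker (α m : E →ₗ[ℝ] ℝ)

/-- `P` is the linearized return map along the closed Reeb orbit covered by the trajectory
`c : [0, T] → ℍ × ℝ`: the derivative of the time `T` flow from the contact plane at `c 0` to that at
`c T`, which is identified with the one at `c 0` by the element of `Γ` that takes `c 0` to `c T`
(it is unique, as the action on `ℍ × ℝ` is free). -/
def IsLinearizedReturn (Γ : Subgroup (Equiv.Perm (ℍ × ℂ))) (α : E → E →L[ℝ] ℝ) (c : ℝ → ℍ × ℝ)
    (T : ℝ) (P : Module.End ℝ (contactPlane α (coord (c 0)))) : Prop :=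
  ∃ D, IsLinearizedFlow α (coord (c 0)) T D ∧ ∃ g ∈ Γ, g (unitTangent (c 0)) = unitTangent (c T) ∧
    ∀ v : contactPlane α (coord (c 0)),
      fderiv ℝ (actCoord g) (coord (c 0)) (P v : E) = D T (v : E)

/-- The Reeb orbit `γ` of period `T` is nondegenerate: `1` is not an eigenvalue of its linearized
return map. -/
def IsNondegenerate (Γ : Subgroup (Equiv.Perm (ℍ × ℂ))) (α : E → E →L[ℝ] ℝ) (γ : ℝ → QuotSpace Γ)
    (T : ℝ) : Prop :=
  ∃ c, IsReebLift Γ α γ c ∧ ∃ P, IsLinearizedReturn Γ α c T P ∧ ¬ Module.End.HasEigenvalue P 1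

/-- The Reeb orbit `γ` of period `T` is elliptic: the (complex) eigenvalues of its linearized
return map lie on the unit circle. -/
def IsElliptic (Γ : Subgroup (Equiv.Perm (ℍ × ℂ))) (α : E → E →L[ℝ] ℝ) (γ : ℝ → QuotSpace Γ)
    (T : ℝ) : Prop :=
  ∃ c, IsReebLift Γ α γ c ∧ ∃ P, IsLinearizedReturn Γ α c T P ∧
    ∀ μ : ℂ, (P.charpoly.map (algebraMap ℝ ℂ)).IsRoot μ → ‖μ‖ = 1

/-! ## The Conley–Zehnder index -/

/-- Rotation of the plane by the angle `x`. -/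
def rot (x : ℝ) : Matrix (Fin 2) (Fin 2) ℝ := !![Real.cos x, -Real.sin x; Real.sin x, Real.cos x]

/-- Elliptic case of the index: a homotopy `B u`, `u ∈ [0, 1]`, of changes of frame along the closed
orbit, starting at the identity, turns `A` into the path of rotations by the angles `2 π θ t`, with
`θ` continuous and `θ 0 = 0`; the index is `2 ⌊θ T⌋ + 1`. -/
def EllipticIndex (A : ℝ → Matrix (Fin 2) (Fin 2) ℝ) (T : ℝ) (k : ℤ) : Prop :=
  ∃ (B : ℝ → ℝ → Matrix (Fin 2) (Fin 2) ℝ) (θ : ℝ → ℝ),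
    ContinuousOn (fun x : ℝ × ℝ => B x.1 x.2) (Set.Icc 0 1 ×ˢ Set.Icc 0 T) ∧
    (∀ u ∈ Set.Icc (0 : ℝ) 1, (∀ t ∈ Set.Icc 0 T, 0 < (B u t).det) ∧ B u 0 = B u T) ∧
    (∀ t ∈ Set.Icc 0 T, B 0 t = 1) ∧
    ContinuousOn θ (Set.Icc 0 T) ∧ θ 0 = 0 ∧
    (∀ t ∈ Set.Icc 0 T, B 1 t * A t = rot (2 * Real.pi * θ t) * B 1 0) ∧
    k = 2 * ⌊θ T⌋ + 1

/-- Hyperbolic case of the index: an eigenvector of `A T` is rotated by `A` through the total angle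
`k * π`. -/
def HyperbolicIndex (A : ℝ → Matrix (Fin 2) (Fin 2) ℝ) (T : ℝ) (k : ℤ) : Prop :=
  ∃ (v : Fin 2 → ℝ) (μ : ℝ) (ρ ϑ : ℝ → ℝ), v ≠ 0 ∧ (A T).mulVec v = μ • v ∧
    ContinuousOn ϑ (Set.Icc 0 T) ∧
    (∀ t ∈ Set.Icc 0 T, 0 < ρ t ∧
      (A t).mulVec v = ρ t • ![Real.cos (ϑ t), Real.sin (ϑ t)]) ∧
    ϑ T - ϑ 0 = k * Real.pi

/-- `k` is the Conley–Zehnder index of the path `A : [0, T] → SL(2, ℝ)` that starts at the identity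
and ends at a matrix without eigenvalue `1`. -/
def IsCZIndexOfPath (A : ℝ → Matrix (Fin 2) (Fin 2) ℝ) (T : ℝ) (k : ℤ) : Prop :=
  (A T - 1).det ≠ 0 ∧ (EllipticIndex A T k ∨ HyperbolicIndex A T k)

/-- `e` descends to a global positively oriented trivialization of the contact structure of `α` on
`Γ \ (ℍ × ℝ)`. -/
structure IsTrivialization (Γ : Subgroup (Equiv.Perm (ℍ × ℂ))) (α : E → E →L[ℝ] ℝ)
    (e : Fin 2 → E → E) : Prop where
  smooth : ∀ i, ContDiffOn ℝ ∞ (e i) halfSpace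
  tangent : ∀ i, ∀ m ∈ halfSpace, α m (e i m) = 0
  positive : ∀ m ∈ halfSpace, 0 < dForm α m (e 0 m) (e 1 m)
  invariant : ∀ g ∈ Γ, ∀ i, ∀ m ∈ halfSpace,
    fderiv ℝ (actCoord g) m (e i m) = e i (actCoord g m)

/-- `k` is the Conley–Zehnder index of the Reeb orbit `γ` of period `T` with respect to the
trivialization `e`: the index of the linearized flow along `γ`, written as a path of matrices in the
frame `e`. -/
def HasCZIndex (Γ : Subgroup (Equiv.Perm (ℍ × ℂ))) (α : E → E →L[ℝ] ℝ) (e : Fin 2 → E → E)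
    (γ : ℝ → QuotSpace Γ) (T : ℝ) (k : ℤ) : Prop :=
  IsTrivialization Γ α e ∧ ∃ c, IsReebLift Γ α γ c ∧
    ∃ D, IsLinearizedFlow α (coord (c 0)) T D ∧
    ∃ A : ℝ → Matrix (Fin 2) (Fin 2) ℝ,
      (∀ t ∈ Set.Icc 0 T, ∀ j, D t (e j (coord (c 0))) = ∑ i, A t i j • e i (coord (c t))) ∧
      IsCZIndexOfPath A T k

/-! ## The particular contact form, trivialization and orbit -/

/-- The invariant contact form `λ = dt + (1 / y) dx`. -/
def stdForm (m : E) : E →L[ℝ] ℝ :=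
  ContinuousLinearMap.snd ℝ ℂ ℝ +
    (1 / m.1.im) • Complex.reCLM.comp (ContinuousLinearMap.fst ℝ ℂ ℝ)

/-- The squared absolute value of the differential of degree `a` with coefficient `F`, as a function
on `ℍ × ℝ`. -/
def normSqForm (a : ℚ) (F : ℍ → ℂ) (m : E) : ℝ :=
  ‖differential a F (unitTangent (ofComplex m.1, m.2))‖ ^ 2

/-- The contact form `f λ`, where `f = 1 + ε |φ|²`. -/
def perturbedForm (a : ℚ) (F : ℍ → ℂ) (ε : ℝ) (m : E) : E →L[ℝ] ℝ :=
  (1 + ε * normSqForm a F m) • stdForm m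

/-- The invariant trivialization `e₁ = (y cos t, y sin t, -cos t)`, `e₂ = (-y sin t, y cos t, sin t)`
of `ker λ`. -/
def frame : Fin 2 → E → E :=
  ![fun m => (⟨m.1.im * Real.cos m.2, m.1.im * Real.sin m.2⟩, -Real.cos m.2),
    fun m => (⟨-(m.1.im * Real.sin m.2), m.1.im * Real.cos m.2⟩, Real.sin m.2)]

/-- The fibre over `v`, parametrized by `t ↦ [(v, t)]`. -/
def fibre (Γ : Subgroup (Equiv.Perm (ℍ × ℂ))) (v : ℍ) (t : ℝ) : QuotSpace Γ := proj Γ (v, t)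

/-- The number `s` with `1 / s = 1 - 1 / p - 1 / q - 1 / r`. -/
def sNum (p q r : ℕ) : ℚ := (1 - 1 / (p : ℚ) - 1 / (q : ℚ) - 1 / (r : ℚ))⁻¹

end Brieskorn

end

/-! The function `|φ₁|²` does not depend on `t`: it is `|F|² y^(2a)` on the upper half-plane. So `f
λ` is `λ` rescaled by a positive function `f` of `z`, and its Reeb field is independent of `t`. Its
horizontal part is `-i y² (f_x + i f_y) / f²`, a Hamiltonian field for the hyperbolic area. At a
zero `v₁` of `F` one has `f = 1` and `df = 0`, so the Reeb field is `∂_t` and the fibre is a Reeb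
trajectory. Because the zero is simple, the horizontal part linearizes to `u ↦ -i ε κ u` with `κ =
rotSpeed > 0`: a slow clockwise rotation (`fst_reebCoeff_of_zero`, `hasFDerivAt_reebField`). The
frame has horizontal part `y e^(it)` and itself turns counterclockwise at unit speed, so in it the
linearized flow is rotation by `-(1 + ε κ) t` (`linFlow_frame`).

At time `2π n qr/s` this rotation has made `-(1 + ε κ) n qr/s` turns. For small `ε` and `n ≤ N` this
number lies strictly between `-⌊n qr/s⌋ - 1` and `-⌊n qr/s⌋` (`exists_small_rotation`), which gives
nondegeneracy and the index `2 (-⌊n qr/s⌋ - 1) + 1`. The strictness at the upper end comes from `κ >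
0`; it is needed when `n qr/s` is an integer, where the unperturbed return map is the identity.

That the fibre closes up after `2π qr/s` is a statement about `Π`. The labeled rotations by `2π/p,
2π/q, 2π/r` about the vertices have powers of orders `p, q, r` equal to the central translation `c`
by `2π`, and their product is `c` too (`labeledRot_pow_eq`, `labeledRot_mul_mul`). In the
abelianization this forces `c^(qr) = x₁^(qr) c^r c^q`. The quotient of the two sides lies in `Π` and
translates the fibre over `v₁` by `2π qr (1 - 1/p - 1/q - 1/r)` (`exists_mem_piGroup`). -/

noncomputable section

namespace Brieskorn

/-! ## Flows of bounded Lipschitz vector fields -/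

section Flow

variable {V : Type*} [NormedAddCommGroup V] [NormedSpace ℝ V]

/-- `ψ` is the flow of the autonomous vector field `X` for times in `[0, T]`. -/
def IsFlow (X : V → V) (T : ℝ) (ψ : ℝ → V → V) : Prop :=
  ∀ x, ψ 0 x = x ∧ ∀ t ∈ Set.Icc 0 T,
    HasDerivWithinAt (fun u => ψ u x) (X (ψ t x)) (Set.Icc 0 T) t

lemma exists_isFlow [CompleteSpace V] {X : V → V} {K : NNReal} (hX : LipschitzWith K X)
    {L : ℝ} (hL : ∀ x, ‖X x‖ ≤ L) {T : ℝ} (hT : 0 ≤ T) : ∃ ψ, IsFlow X T ψ := by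
  have hL0 : 0 ≤ L := (norm_nonneg _).trans (hL 0)
  have key : ∀ x, ∃ α : ℝ → V, α 0 = x ∧ ∀ t ∈ Set.Icc 0 T,
      HasDerivWithinAt α (X (α t)) (Set.Icc 0 T) t := by
    intro x
    -- A field bounded by `L` moves a point by at most `L T` in time `T`; with a ball of this radius
    -- the local existence theorem already covers all of `[0, T]`.
    have hpl : IsPicardLindelof (fun _ : ℝ => X) (⟨0, by simp [hT]⟩ : Set.Icc (0 : ℝ) T) x
        (L.toNNReal * T.toNNReal) 0 L.toNNReal K :=
      { lipschitzOnWith := fun _ _ => hX.lipschitzOnWith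
        continuousOn := fun _ _ => continuousOn_const
        norm_le := fun _ _ y _ => by rw [Real.coe_toNNReal _ hL0]; exact hL y
        mul_max_le := by simp [hL0, hT] }
    exact hpl.exists_eq_forall_mem_Icc_hasDerivWithinAt₀
  choose α h0 hα using key
  exact ⟨fun t x => α x t, fun x => ⟨h0 x, hα x⟩⟩

lemma IsFlow.continuousOn {X : V → V} {T : ℝ} {ψ : ℝ → V → V} (h : IsFlow X T ψ) (x : V) :
    ContinuousOn (fun u => ψ u x) (Set.Icc 0 T) :=
  fun t ht => ((h x).2 t ht).continuousWithinAt

lemma hasDerivWithinAt_Ici_of_Icc {f : ℝ → V} {f' : V} {T t : ℝ}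
    (h : HasDerivWithinAt f f' (Set.Icc 0 T) t) (ht : t ∈ Set.Ico 0 T) :
    HasDerivWithinAt f f' (Set.Ici t) t :=
  h.mono_of_mem_nhdsWithin (Filter.mem_of_superset (Icc_mem_nhdsGE ht.2)
    (Set.Icc_subset_Icc_left ht.1))

/-- Exponential bound for the distance to the trajectory of a relative equilibrium `x₀`. -/
lemma IsFlow.norm_sub_le {X : V → V} {K : NNReal} (hX : LipschitzWith K X) {T : ℝ}
    {ψ : ℝ → V → V} (h : IsFlow X T ψ) {x₀ e : V} (he : ∀ s : ℝ, X (x₀ + s • e) = e) (x : V)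
    {t : ℝ} (ht : t ∈ Set.Icc 0 T) :
    ‖ψ t x - (x₀ + t • e)‖ ≤ ‖x - x₀‖ * Real.exp (K * t) := by
  have hb : ∀ t : ℝ, HasDerivAt (fun s : ℝ => x₀ + s • e) e t := fun t => by
    simpa using ((hasDerivAt_id t).smul_const e).const_add x₀
  have := norm_le_gronwallBound_of_norm_deriv_right_le (δ := ‖x - x₀‖) (K := K) (ε := 0)
    (f := fun t => ψ t x - (x₀ + t • e)) (f' := fun t => X (ψ t x) - e) (a := 0) (b := T)
    ((h.continuousOn x).sub (fun t _ => (hb t).continuousAt.continuousWithinAt))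
    (fun t ht => (hasDerivWithinAt_Ici_of_Icc ((h x).2 t (Set.Ico_subset_Icc_self ht)) ht).sub
      (hb t).hasDerivWithinAt)
    (by simp [(h x).1])
    (fun t _ => by
      have := hX.norm_sub_le (ψ t x) (x₀ + t • e)
      rw [he] at this
      simpa using this) t ht
  simpa [gronwallBound_ε0] using this

/-- The flow is differentiable at a relative equilibrium `x₀`, and its derivative solves the
linearized equation. -/
lemma IsFlow.hasFDerivAt {X : V → V} {K : NNReal} (hX : LipschitzWith K X) {T : ℝ}
    {ψ : ℝ → V → V} (h : IsFlow X T ψ) {x₀ e : V} (hinv : ∀ x, ∀ s : ℝ, X (x + s • e) = X x)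
    (he : X x₀ = e) {A : V →L[ℝ] V} (hA : HasFDerivAt X A x₀) {D : ℝ → V →L[ℝ] V}
    (hD0 : ∀ v, D 0 v = v) (hD : ∀ v t, HasDerivAt (fun s => D s v) (A (D t v)) t)
    {t : ℝ} (ht : t ∈ Set.Icc 0 T) : HasFDerivAt (ψ t) (D t) x₀ := by
  have he' : ∀ s : ℝ, X (x₀ + s • e) = e := fun s => by rw [hinv, he]
  have hb : ∀ t : ℝ, HasDerivAt (fun s : ℝ => x₀ + s • e) e t := fun t => by
    simpa using ((hasDerivAt_id t).smul_const e).const_add x₀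
  have hT : 0 ≤ T := ht.1.trans ht.2
  have hbase : ψ t x₀ = x₀ + t • e := by
    have := h.norm_sub_le hX he' x₀ ht
    simpa [sub_eq_zero] using this
  set M := Real.exp (K * T) with hM
  have hMpos : 0 < M := Real.exp_pos _
  set C := gronwallBound 0 ‖A‖ M T with hC
  -- With zero initial error the Gronwall bound is linear in the forcing term, so `C` does not
  -- depend on the tolerance.
  have hgb : ∀ δ : ℝ, gronwallBound 0 ‖A‖ (δ * M) T = δ * C := by
    intro δ
    rw [hC]
    unfold gronwallBound
    split_ifs <;> ring
  have hC0 : 0 ≤ C := by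
    have := gronwallBound_mono (le_refl (0 : ℝ)) hMpos.le (norm_nonneg A) hT
    rwa [gronwallBound_x0] at this
  rw [hasFDerivAt_iff_isLittleO, Asymptotics.isLittleO_iff]
  intro c hc
  -- Makes `δ * C ≤ c`; the `+ 1` keeps the denominator positive when `C = 0`.
  set δ := c / (C + 1) with hδ
  have hδpos : 0 < δ := by positivity
  have hA' := (hasFDerivAt_iff_isLittleO.1 hA).def hδpos
  obtain ⟨η, hη, hball⟩ := Metric.eventually_nhds_iff.1 hA'
  have hnear : ∀ᶠ x in 𝓝 x₀, ‖x - x₀‖ * M < η := by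
    have : Filter.Tendsto (fun x => ‖x - x₀‖ * M) (𝓝 x₀) (𝓝 (‖x₀ - x₀‖ * M)) :=
      (Continuous.tendsto (by fun_prop) x₀)
    rw [sub_self, norm_zero, zero_mul] at this
    exact this.eventually_lt_const hη
  filter_upwards [hnear] with x hx
  have hclose : ∀ s ∈ Set.Icc 0 T, ‖ψ s x - (x₀ + s • e)‖ ≤ ‖x - x₀‖ * M := by
    intro s hs
    refine (h.norm_sub_le hX he' x hs).trans ?_
    rw [hM]
    gcongr
    exact hs.2
  have hbound : ∀ s ∈ Set.Ico 0 T, ‖X (ψ s x) - e - A (D s (x - x₀))‖ ≤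
      ‖A‖ * ‖ψ s x - (x₀ + s • e) - D s (x - x₀)‖ + δ * (‖x - x₀‖ * M) := by
    intro s hs
    have hs' := hclose s (Set.Ico_subset_Icc_self hs)
    set y := ψ s x - (x₀ + s • e) with hy
    -- Translation invariance moves the point back along the base trajectory, so that
    -- differentiability of `X` at the single point `x₀` suffices for all times.
    have h1 : X (ψ s x) = X (x₀ + y) := by
      rw [← hinv (x₀ + y) s]
      congr 1
      rw [hy]; abel
    have h2 : ‖X (x₀ + y) - X x₀ - A y‖ ≤ δ * ‖y‖ := by
      have := @hball (x₀ + y) (by simpa [dist_eq_norm] using hs'.trans_lt hx)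
      simpa using this
    have h3 : X (ψ s x) - e - A (D s (x - x₀)) =
        (X (x₀ + y) - X x₀ - A y) + A (y - D s (x - x₀)) := by
      rw [h1, he, map_sub A y]; abel
    rw [h3]
    have h4 := A.le_opNorm (y - D s (x - x₀))
    calc _ ≤ δ * ‖y‖ + ‖A‖ * ‖y - D s (x - x₀)‖ := norm_add_le_of_le h2 h4
      _ ≤ δ * (‖x - x₀‖ * M) + ‖A‖ * ‖y - D s (x - x₀)‖ := by gcongr
      _ = _ := add_comm _ _
  have hgr := norm_le_gronwallBound_of_norm_deriv_right_le (δ := 0) (K := ‖A‖)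
    (ε := δ * (‖x - x₀‖ * M))
    (f := fun s => ψ s x - (x₀ + s • e) - D s (x - x₀))
    (f' := fun s => X (ψ s x) - e - A (D s (x - x₀))) (a := 0) (b := T)
    (((h.continuousOn x).sub (fun t _ => (hb t).continuousAt.continuousWithinAt)).sub
      (fun s _ => (hD _ s).continuousAt.continuousWithinAt))
    (fun s hs => ((hasDerivWithinAt_Ici_of_Icc ((h x).2 s (Set.Ico_subset_Icc_self hs)) hs).sub
      (hb s).hasDerivWithinAt).sub (hD _ s).hasDerivWithinAt)
    (by simp [(h x).1, hD0]) hbound t ht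
  rw [hbase]
  refine hgr.trans ?_
  calc gronwallBound 0 ‖A‖ (δ * (‖x - x₀‖ * M)) (t - 0)
      ≤ gronwallBound 0 ‖A‖ (δ * (‖x - x₀‖ * M)) T :=
        gronwallBound_mono le_rfl (by positivity) (norm_nonneg _) (by simpa using ht.2)
    _ = δ * ‖x - x₀‖ * C := by rw [← hgb]; ring_nf
    _ = c * ‖x - x₀‖ * (C / (C + 1)) := by rw [hδ]; field_simp
    _ ≤ c * ‖x - x₀‖ * 1 := by
        gcongr
        rw [div_le_one (by positivity)]
        linarith
    _ = c * ‖x - x₀‖ := mul_one _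

end Flow

/-! ## Labels of Moebius transformations -/

/-- The denominator `c z + d` of a Moebius transformation. -/
def den (A : SL(2, ℝ)) (z : ℂ) : ℂ := A 1 0 * z + A 1 1

lemma den_ne_zero (A : SL(2, ℝ)) (z : ℍ) : den A z ≠ 0 :=
  UpperHalfPlane.denom_ne_zero (Matrix.SpecialLinearGroup.mapGL ℝ A : GL (Fin 2) ℝ) z

lemma hasDerivAt_moebius (A : SL(2, ℝ)) (z : ℍ) :
    HasDerivAt (fun x : ℂ => ((A • ofComplex x : ℍ) : ℂ)) (1 / den A z ^ 2) z := by
  have h : 0 < (Matrix.SpecialLinearGroup.mapGL ℝ A : GL (Fin 2) ℝ).val.det := by simp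
  have h2 := (hasStrictDerivAt_smul h z).hasDerivAt
  have h3 : ((Matrix.SpecialLinearGroup.mapGL ℝ A : GL (Fin 2) ℝ).val.det : ℂ) = 1 := by simp
  rw [h3] at h2
  exact h2

lemma im_moebius (A : SL(2, ℝ)) (z : ℍ) : (A • z).im = z.im / ‖den A z‖ ^ 2 := by
  have := UpperHalfPlane.im_smul_eq_div_normSq (Matrix.SpecialLinearGroup.mapGL ℝ A : GL (Fin 2) ℝ) z
  rw [Complex.normSq_eq_norm_sq] at this
  have h3 : |((Matrix.SpecialLinearGroup.mapGL ℝ A : GL (Fin 2) ℝ).det.val : ℝ)| = 1 := by simp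
  rw [h3, one_mul] at this
  exact this

/-- `ℓ` is a continuous lift of the derivative of `A` through `w ↦ exp (I * w)`. -/
structure IsLabel (A : SL(2, ℝ)) (ℓ : ℍ → ℂ) : Prop where
  continuous : Continuous ℓ
  exp_eq : ∀ z : ℍ, Complex.exp (Complex.I * ℓ z) = 1 / den A z ^ 2

lemma mem_labeledLift_iff {S : Subgroup SL(2, ℝ)} {g : Equiv.Perm (ℍ × ℂ)} :
    g ∈ labeledLift S ↔ ∃ A ∈ S, ∃ ℓ, IsLabel A ℓ ∧ ∀ z w, g (z, w) = (A • z, w + ℓ z) := by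
  constructor
  · rintro ⟨A, hA, ℓ, hc, hd, hg⟩
    exact ⟨A, hA, ℓ, ⟨hc, fun z => by rw [hd, (hasDerivAt_moebius A z).deriv]⟩, hg⟩
  · rintro ⟨A, hA, ℓ, hl, hg⟩
    exact ⟨A, hA, ℓ, hl.continuous,
      fun z => by rw [hl.exp_eq, (hasDerivAt_moebius A z).deriv], hg⟩

lemma continuousAt_ofComplex {z : ℂ} (hz : 0 < z.im) : ContinuousAt ofComplex z := by
  have h := (contMDiffAt_ofComplex (n := 0) hz).continuousAt
  exact h

lemma hasDerivAt_den (A : SL(2, ℝ)) (z : ℂ) : HasDerivAt (den A) (A 1 0 : ℂ) z := by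
  have h := ((hasDerivAt_id z).const_mul (A 1 0 : ℂ)).add_const (A 1 1 : ℂ)
  rw [mul_one] at h
  exact h

/-- A label is holomorphic. -/
lemma IsLabel.hasDerivAt {A : SL(2, ℝ)} {ℓ : ℍ → ℂ} (h : IsLabel A ℓ) (z : ℍ) :
    HasDerivAt (ℓ ∘ ofComplex) (2 * Complex.I * A 1 0 / den A z) z := by
  have hcont : ContinuousAt (ℓ ∘ ofComplex) (z : ℂ) :=
    h.continuous.continuousAt.comp (continuousAt_ofComplex z.im_pos)
  have hj := den_ne_zero A z
  -- Near `z` the label coincides with this principal branch: by continuity `I * (ℓ x - ℓ z)` has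
  -- imaginary part below `π` in absolute value, where `log` inverts `exp`.
  have hder : HasDerivAt (fun x : ℂ => ℓ z - Complex.I * Complex.log ((den A z) ^ 2 / den A x ^ 2))
      (2 * Complex.I * A 1 0 / den A z) z := by
    have h1 : HasDerivAt (fun x : ℂ => (den A z) ^ 2 / den A x ^ 2)
        (-2 * A 1 0 / den A z) z := by
      have h2 := ((hasDerivAt_den A z).pow 2).fun_inv (pow_ne_zero 2 hj)
      convert! h2.const_mul (den A z ^ 2) using 1
      simp only [Pi.pow_apply]
      field_simp
      push_cast
      ring
    have h2 := h1.clog (by rw [div_self (pow_ne_zero 2 hj)]; exact Complex.one_mem_slitPlane)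
    convert! (h2.const_mul Complex.I).const_sub (ℓ z) using 1
    field_simp
  refine hder.congr_of_eventuallyEq ?_
  have him : ∀ᶠ x in 𝓝 (z : ℂ),
      |(Complex.I * ((ℓ ∘ ofComplex) x - ℓ z)).im| < Real.pi := by
    have ht : Filter.Tendsto (fun x : ℂ => |(Complex.I * ((ℓ ∘ ofComplex) x - ℓ z)).im|)
        (𝓝 (z : ℂ)) (𝓝 |(Complex.I * ((ℓ ∘ ofComplex) z - ℓ z)).im|) := by
      apply Filter.Tendsto.abs
      exact (Complex.continuous_im.tendsto _).comp ((hcont.tendsto.sub_const _).const_mul _)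
    refine ht.eventually_lt_const ?_
    simpa using Real.pi_pos
  have hpos : ∀ᶠ x in 𝓝 (z : ℂ), 0 < x.im :=
    Complex.continuous_im.continuousAt.eventually_const_lt z.im_pos
  filter_upwards [him, hpos] with x hx hx0
  have e1 := h.exp_eq z
  have e2 := h.exp_eq (ofComplex x)
  have hxc : ((ofComplex x : ℍ) : ℂ) = x := by rw [ofComplex_apply_of_im_pos hx0]
  rw [hxc] at e2
  have e3 : (den A z) ^ 2 / den A x ^ 2 = Complex.exp (Complex.I * ((ℓ ∘ ofComplex) x - ℓ z)) := by
    rw [mul_sub, Complex.exp_sub, Function.comp_apply, e1, e2]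
    field_simp
  rw [e3, Complex.log_exp (neg_lt_of_abs_lt hx) (lt_of_abs_lt hx).le, ← mul_assoc, Complex.I_mul_I]
  ring

/-- The modulus of `A'(z)` is `Im (A z) / Im z`. Hence `Im ℓ` is exactly the change of `-log y`,
which is why labeled maps preserve the image of `unitTangent`. -/
lemma IsLabel.exp_neg_im {A : SL(2, ℝ)} {ℓ : ℍ → ℂ} (h : IsLabel A ℓ) (z : ℍ) :
    Real.exp (-(ℓ z).im) = (A • z).im / z.im := by
  have h1 := congrArg norm (h.exp_eq z)
  rw [Complex.norm_exp] at h1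
  have hz := z.im_pos.ne'
  rw [im_moebius]
  simp only [Complex.mul_re, Complex.I_re, zero_mul, Complex.I_im, one_mul, zero_sub] at h1
  rw [h1]
  simp
  field_simp

lemma IsLabel.im_eq {A : SL(2, ℝ)} {ℓ : ℍ → ℂ} (h : IsLabel A ℓ) (z : ℍ) :
    (ℓ z).im = Real.log z.im - Real.log (A • z).im := by
  have h1 := congrArg Real.log (h.exp_neg_im z)
  rw [Real.log_exp, Real.log_div (A • z).im_pos.ne' z.im_pos.ne'] at h1
  linarith

/-- The argument of `A'(z)` is `Re ℓ`. This relates the turning of tangent vectors under `A` to the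
shift of `t`, as invariance of the frame requires. -/
lemma IsLabel.exp_re {A : SL(2, ℝ)} {ℓ : ℍ → ℂ} (h : IsLabel A ℓ) (z : ℍ) :
    ((A • z).im : ℂ) * Complex.exp (Complex.I * (ℓ z).re) = z.im / den A z ^ 2 := by
  have h1 := h.exp_eq z
  have h2 : Complex.I * ℓ z = Complex.I * (ℓ z).re + ((-(ℓ z).im : ℝ) : ℂ) := by
    apply Complex.ext <;> simp
  rw [h2, Complex.exp_add, ← Complex.ofReal_exp, h.exp_neg_im] at h1
  have hz : (z.im : ℂ) ≠ 0 := by exact_mod_cast z.im_pos.ne'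
  have hA : ((A • z).im : ℂ) ≠ 0 := by exact_mod_cast (A • z).im_pos.ne'
  push_cast at h1
  field_simp at h1 ⊢
  linear_combination h1

/-! ## The action on `ℍ × ℝ` -/

lemma exists_coord {m : E} (hm : m ∈ halfSpace) : ∃ z t, m = coord (z, t) :=
  ⟨⟨m.1, hm⟩, m.2, rfl⟩

section Action

variable {A : SL(2, ℝ)} {ℓ : ℍ → ℂ} {g : Equiv.Perm (ℍ × ℂ)}

lemma actCoord_eq (hg : ∀ z w, g (z, w) = (A • z, w + ℓ z)) (m : E) :
    actCoord g m = (((A • ofComplex m.1 : ℍ) : ℂ), m.2 + (ℓ (ofComplex m.1)).re) := by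
  simp [actCoord, unitTangent, hg]

lemma actCoord_coord (hg : ∀ z w, g (z, w) = (A • z, w + ℓ z)) (z : ℍ) (t : ℝ) :
    actCoord g (coord (z, t)) = coord (A • z, t + (ℓ z).re) := by
  rw [actCoord_eq hg]
  simp [coord]

lemma apply_unitTangent (hl : IsLabel A ℓ) (hg : ∀ z w, g (z, w) = (A • z, w + ℓ z)) (z : ℍ)
    (t : ℝ) : g (unitTangent (z, t)) = unitTangent (A • z, t + (ℓ z).re) := by
  simp only [unitTangent, hg]
  congr 1
  have h := hl.im_eq z
  apply Complex.ext
  · simp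
  · simp [h]
    ring

/-- The derivative of the action of a labeled map. -/
def actDeriv (A : SL(2, ℝ)) (z : ℍ) : E →L[ℝ] E :=
  (((1 / den A z ^ 2 : ℂ) • ContinuousLinearMap.id ℂ ℂ).restrictScalars ℝ ∘L
    ContinuousLinearMap.fst ℝ ℂ ℝ).prod
  (ContinuousLinearMap.snd ℝ ℂ ℝ + Complex.reCLM ∘L
    (((2 * Complex.I * A 1 0 / den A z : ℂ) • ContinuousLinearMap.id ℂ ℂ).restrictScalars ℝ ∘L
      ContinuousLinearMap.fst ℝ ℂ ℝ))

lemma actDeriv_apply (A : SL(2, ℝ)) (z : ℍ) (v : E) :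
    actDeriv A z v = (1 / den A z ^ 2 * v.1, v.2 + (2 * Complex.I * A 1 0 / den A z * v.1).re) :=
  rfl

lemma hasFDerivAt_actCoord (hl : IsLabel A ℓ) (hg : ∀ z w, g (z, w) = (A • z, w + ℓ z)) (z : ℍ)
    (t : ℝ) : HasFDerivAt (actCoord g) (actDeriv A z) (coord (z, t)) := by
  have h0 : actCoord g = fun m : E =>
      (((A • ofComplex m.1 : ℍ) : ℂ), m.2 + ((ℓ ∘ ofComplex) m.1).re) := by
    funext m
    exact actCoord_eq hg m
  rw [h0]
  have h1 : HasFDerivAt (fun m : E => ((A • ofComplex m.1 : ℍ) : ℂ))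
      (((1 / den A z ^ 2 : ℂ) • ContinuousLinearMap.id ℂ ℂ).restrictScalars ℝ ∘L
        ContinuousLinearMap.fst ℝ ℂ ℝ) (coord (z, t)) := by
    have h2 : HasFDerivAt (fun x : ℂ => ((A • ofComplex x : ℍ) : ℂ))
        ((1 / den A z ^ 2 : ℂ) • ContinuousLinearMap.id ℂ ℂ) (z : ℂ) := by
      convert! (hasDerivAt_moebius A z).hasFDerivAt using 1
      ext; simp
    exact HasFDerivAt.comp (f := Prod.fst) (coord (z, t)) (h2.restrictScalars ℝ) hasFDerivAt_fst
  have h2 : HasFDerivAt (fun m : E => ((ℓ ∘ ofComplex) m.1).re)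
      (Complex.reCLM ∘L
      (((2 * Complex.I * A 1 0 / den A z : ℂ) • ContinuousLinearMap.id ℂ ℂ).restrictScalars ℝ ∘L
        ContinuousLinearMap.fst ℝ ℂ ℝ)) (coord (z, t)) := by
    have h2 : HasFDerivAt (ℓ ∘ ofComplex)
        ((2 * Complex.I * A 1 0 / den A z : ℂ) • ContinuousLinearMap.id ℂ ℂ) (z : ℂ) := by
      convert! (hl.hasDerivAt z).hasFDerivAt using 1
      ext; simp
    exact HasFDerivAt.comp (g := Complex.re) (f := fun m : E => (ℓ ∘ ofComplex) m.1)
      (coord (z, t)) Complex.reCLM.hasFDerivAt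
      (HasFDerivAt.comp (f := Prod.fst) (coord (z, t)) (h2.restrictScalars ℝ) hasFDerivAt_fst)
  exact h1.prodMk (hasFDerivAt_snd.add h2)

lemma stdForm_apply (m v : E) : stdForm m v = v.2 + 1 / m.1.im * v.1.re := by
  simp [stdForm]

lemma stdForm_actDeriv (A : SL(2, ℝ)) (z : ℍ) (t s : ℝ) (v : E) :
    stdForm (coord (A • z, s)) (actDeriv A z v) = stdForm (coord (z, t)) v := by
  have hj := den_ne_zero A z
  have hz : (z.im : ℂ) ≠ 0 := by exact_mod_cast z.im_pos.ne'
  rw [stdForm_apply, stdForm_apply, actDeriv_apply]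
  simp only [coord, coe_im]
  rw [im_moebius, add_assoc]
  congr 1
  -- A complex identity whose real part is the claim. It rests on `|j|² = j * conj j` and `conj j =
  -- j - 2 i c y` for the denominator `j = c z + d`.
  have key : (1 / (z.im / ‖den A z‖ ^ 2 : ℝ) : ℂ) * (1 / den A z ^ 2 * v.1) +
      2 * Complex.I * A 1 0 / den A z * v.1 = (1 / z.im : ℝ) * v.1 := by
    have hn : ((‖den A z‖ ^ 2 : ℝ) : ℂ) = den A z * (starRingEnd ℂ) (den A z) := by
      rw [Complex.mul_conj, Complex.normSq_eq_norm_sq]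
    have hc : (starRingEnd ℂ) (den A z) = den A z - 2 * Complex.I * A 1 0 * z.im := by
      apply Complex.ext <;> simp [den]; ring
    rw [Complex.ofReal_div, hn, hc]
    push_cast
    have hnn : den A z - 2 * Complex.I * A 1 0 * z.im ≠ 0 := by
      rw [← hc]; simpa using hj
    field_simp
    ring
  have := congrArg Complex.re key
  rw [Complex.add_re, Complex.re_ofReal_mul] at this
  rw [← this, add_comm]
  congr 1
  rw [← Complex.re_ofReal_mul]
  push_cast
  rfl

/-- The horizontal parts of the frame are `y e^(it)` and `i y e^(it)`, which `A'` transports by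
`IsLabel.exp_re`. The vertical parts then follow, since both sides lie in the kernel of the
invariant form `λ`. -/
lemma frame_actDeriv (hl : IsLabel A ℓ) (z : ℍ) (t : ℝ) (i : Fin 2) :
    actDeriv A z (frame i (coord (z, t))) = frame i (coord (A • z, t + (ℓ z).re)) := by
  have hf : ∀ (i : Fin 2) (m : E), (frame i m).1 =
      m.1.im * (Complex.exp (Complex.I * m.2) * Complex.I ^ (i : ℕ)) := by
    intro i m
    rw [mul_comm Complex.I, Complex.exp_mul_I, ← Complex.ofReal_cos, ← Complex.ofReal_sin]
    fin_cases i <;> apply Complex.ext <;> simp [frame] <;>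
      first
        | exact Or.inl (Complex.cos_ofReal_re _).symm
        | exact Or.inl (Complex.sin_ofReal_re _).symm
  have hk : ∀ (i : Fin 2) (z : ℍ) (t : ℝ), stdForm (coord (z, t)) (frame i (coord (z, t))) = 0 := by
    intro i z t
    have hz : z.im ≠ 0 := z.im_pos.ne'
    rw [stdForm_apply]
    fin_cases i <;> simp [frame, coord] <;> field_simp <;> ring
  have h1 : (actDeriv A z (frame i (coord (z, t)))).1 =
      (frame i (coord (A • z, t + (ℓ z).re))).1 := by
    rw [actDeriv_apply, hf, hf]
    have := hl.exp_re z
    simp only [coord, coe_im, Complex.ofReal_add, mul_add, Complex.exp_add]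
    linear_combination -(Complex.exp (Complex.I * t) * Complex.I ^ (i : ℕ)) * this
  refine Prod.ext h1 ?_
  have h2 := stdForm_actDeriv A z t (t + (ℓ z).re) (frame i (coord (z, t)))
  rw [hk, ← hk i (A • z) (t + (ℓ z).re), stdForm_apply, stdForm_apply, h1] at h2
  linarith

end Action

/-! ## Rescalings of the invariant contact form -/

/-- The upper half-plane as a subset of `ℂ`. -/
def halfPlane : Set ℂ := {z | 0 < z.im}

lemma isOpen_halfPlane : IsOpen halfPlane :=
  isOpen_lt continuous_const Complex.continuous_im

/-- The one-form `f λ`, for a function `f` on the upper half-plane. -/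
def scaledForm (f : ℂ → ℝ) (m : E) : E →L[ℝ] ℝ := f m.1 • stdForm m

lemma hasFDerivAt_stdForm (z : ℍ) (t : ℝ) :
    HasFDerivAt stdForm
      (((-(1 / z.im ^ 2)) • (Complex.imCLM ∘L ContinuousLinearMap.fst ℝ ℂ ℝ)).smulRight
        (Complex.reCLM ∘L ContinuousLinearMap.fst ℝ ℂ ℝ)) (coord (z, t)) := by
  have him : HasFDerivAt (fun m : E => m.1.im) (Complex.imCLM ∘L ContinuousLinearMap.fst ℝ ℂ ℝ)
      (coord (z, t)) :=
    (Complex.imCLM ∘L ContinuousLinearMap.fst ℝ ℂ ℝ).hasFDerivAt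
  have hinv : HasFDerivAt (fun m : E => 1 / m.1.im)
      ((-(1 / z.im ^ 2)) • (Complex.imCLM ∘L ContinuousLinearMap.fst ℝ ℂ ℝ)) (coord (z, t)) := by
    have h := (hasDerivAt_inv z.im_pos.ne').comp_hasFDerivAt (coord (z, t)) him
    rw [← one_div] at h
    exact h.congr_of_eventuallyEq (Filter.Eventually.of_forall fun m => one_div _)
  exact (hinv.smul_const (Complex.reCLM ∘L ContinuousLinearMap.fst ℝ ℂ ℝ)).const_add
    (ContinuousLinearMap.snd ℝ ℂ ℝ)

section

variable {f : ℂ → ℝ} {f' : ℂ →L[ℝ] ℝ} {z : ℍ} (t : ℝ)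

/-- This is `d(f λ) = df ∧ λ + f dλ`, with `dλ = dx ∧ dy / y²` the hyperbolic area form. -/
lemma dForm_scaledForm (hf : HasFDerivAt f f' z) (v w : E) :
    dForm (scaledForm f) (coord (z, t)) v w =
      f' v.1 * stdForm (coord (z, t)) w - f' w.1 * stdForm (coord (z, t)) v +
        f z * (v.1.re * w.1.im - v.1.im * w.1.re) / z.im ^ 2 := by
  have h1 : HasFDerivAt (fun m : E => f m.1) (f' ∘L ContinuousLinearMap.fst ℝ ℂ ℝ)
      (coord (z, t)) :=
    HasFDerivAt.comp (f := Prod.fst) (coord (z, t)) hf hasFDerivAt_fst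
  have h2 : HasFDerivAt (scaledForm f) _ (coord (z, t)) := h1.smul (hasFDerivAt_stdForm z t)
  rw [dForm, h2.fderiv]
  simp [coord]
  ring

/-- On vertical vectors the condition `d(f λ)(R, ·) = 0` gives `df(X) = 0`; on horizontal ones it
determines `X` through the area form. The last component is then fixed by `λ(R) = 1 / f`. -/
lemma isReebVector_scaledForm (hf : HasFDerivAt f f' z) (hpos : f z ≠ 0) {X : ℂ}
    (hX : X = ⟨z.im ^ 2 * f' Complex.I / f z ^ 2, -(z.im ^ 2 * f' 1 / f z ^ 2)⟩) :
    IsReebVector (scaledForm f) (coord (z, t)) (X, 1 / f z - X.re / z.im) := by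
  have hy := z.im_pos.ne'
  have hlin : ∀ u : ℂ, f' u = u.re * f' 1 + u.im * f' Complex.I := by
    intro u
    conv_lhs => rw [show u = u.re • (1 : ℂ) + u.im • Complex.I by
      apply Complex.ext <;> simp]
    rw [map_add, map_smul, map_smul, smul_eq_mul, smul_eq_mul]
  constructor
  · simp only [scaledForm, smul_apply, stdForm_apply, coord, coe_im,
      smul_eq_mul]
    field_simp
    ring
  · intro w
    rw [dForm_scaledForm t hf, hlin X, hlin w.1, stdForm_apply, stdForm_apply, hX]
    simp only [coord, coe_im]
    field_simp
    ring

end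

section

variable {f : ℂ → ℝ}

lemma contDiffOn_scaledForm (hf : ContDiffOn ℝ ∞ f halfPlane) :
    ContDiffOn ℝ ∞ (scaledForm f) halfSpace := by
  have h1 : ContDiffOn ℝ ∞ (fun m : E => f m.1) halfSpace :=
    hf.comp contDiff_fst.contDiffOn (fun m hm => hm)
  have h2 : ContDiffOn ℝ ∞ (fun m : E => 1 / m.1.im) halfSpace :=
    contDiffOn_const.div (Complex.imCLM.contDiff.comp contDiff_fst).contDiffOn
      fun m hm => ne_of_gt hm
  exact h1.smul (contDiffOn_const.add (h2.smul contDiffOn_const))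

lemma hasFDerivAt_of_contDiffOn (hf : ContDiffOn ℝ ∞ f halfPlane) (z : ℍ) :
    HasFDerivAt f (fderiv ℝ f z) z :=
  ((hf.contDiffAt (isOpen_halfPlane.mem_nhds z.im_pos)).differentiableAt (by simp)).hasFDerivAt

variable {Γ : Subgroup (Equiv.Perm (ℍ × ℂ))}

lemma isContactForm_scaledForm (hΓ : Γ ≤ SLTilde) (hf : ContDiffOn ℝ ∞ f halfPlane)
    (hpos : ∀ z : ℍ, 0 < f z) (hinv : ∀ g ∈ Γ, ∀ x, f (g x).1 = f x.1) :
    IsContactForm Γ (scaledForm f) where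
  smooth := contDiffOn_scaledForm hf
  invariant := by
    intro g hg m hm
    obtain ⟨A, -, ℓ, hl, hgA⟩ := mem_labeledLift_iff.1 (hΓ hg)
    obtain ⟨z, t, rfl⟩ := exists_coord hm
    have hi := hinv g hg (z, 0)
    rw [hgA] at hi
    rw [(hasFDerivAt_actCoord hl hgA z t).fderiv, actCoord_coord hgA]
    ext v
    all_goals
      simp only [scaledForm, ContinuousLinearMap.comp_apply, smul_apply]
      rw [stdForm_actDeriv A z t]
      simp only [coord]
      rw [hi]
  contact := by
    intro m hm
    obtain ⟨z, t, rfl⟩ := exists_coord hm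
    have hy := z.im_pos
    have hfz := hpos z
    simp only [dForm_scaledForm t (hasFDerivAt_of_contDiffOn hf z), scaledForm,
      smul_apply, stdForm_apply, smul_eq_mul]
    simp [coord]
    -- The value of `α ∧ dα` on the coordinate basis is `f² / y²`; the terms with `df` cancel.
    have h : 0 < f z ^ 2 / z.im ^ 2 := by positivity
    convert h using 1
    ring

lemma isTrivialization_frame (hΓ : Γ ≤ SLTilde) (hf : ContDiffOn ℝ ∞ f halfPlane)
    (hpos : ∀ z : ℍ, 0 < f z) : IsTrivialization Γ (scaledForm f) frame where
  smooth := by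
    intro i
    have h1 : ContDiff ℝ ∞ (fun m : E => m.1.im) := Complex.imCLM.contDiff.comp contDiff_fst
    have hc : ContDiff ℝ ∞ (fun m : E => Real.cos m.2) := Real.contDiff_cos.comp contDiff_snd
    have hs : ContDiff ℝ ∞ (fun m : E => Real.sin m.2) := Real.contDiff_sin.comp contDiff_snd
    have hmk : ∀ a b : E → ℝ, ContDiff ℝ ∞ a → ContDiff ℝ ∞ b →
        ContDiff ℝ ∞ (fun m : E => (⟨a m, b m⟩ : ℂ)) := fun a b ha hb =>
      Complex.equivRealProdCLM.symm.contDiff.comp (ha.prodMk hb)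
    fin_cases i
    · exact ((hmk _ _ (h1.mul hc) (h1.mul hs)).prodMk hc.neg).contDiffOn
    · exact ((hmk _ _ (h1.mul hs).neg (h1.mul hc)).prodMk hs).contDiffOn
  tangent := by
    intro i m hm
    have hy : m.1.im ≠ 0 := ne_of_gt hm
    rw [scaledForm, smul_apply, stdForm_apply]
    fin_cases i <;> simp [frame] <;> field_simp <;> simp
  positive := by
    intro m hm
    obtain ⟨z, t, rfl⟩ := exists_coord hm
    have hy := z.im_pos
    have hfz := hpos z
    rw [dForm_scaledForm t (hasFDerivAt_of_contDiffOn hf z), stdForm_apply, stdForm_apply]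
    simp only [frame, coord, Matrix.cons_val_zero, Matrix.cons_val_one, coe_im]
    have := Real.cos_sq_add_sin_sq t
    field_simp
    nlinarith
  invariant := by
    intro g hg i m hm
    obtain ⟨A, -, ℓ, hl, hgA⟩ := mem_labeledLift_iff.1 (hΓ hg)
    obtain ⟨z, t, rfl⟩ := exists_coord hm
    rw [(hasFDerivAt_actCoord hl hgA z t).fderiv, actCoord_coord hgA, frame_actDeriv hl]

end

/-! ## The perturbed form -/

/-- `normSqForm a F` as a function on the upper half-plane. -/
def normSq (a : ℚ) (F : ℍ → ℂ) (z : ℂ) : ℝ :=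
  ‖(F ∘ ofComplex) z‖ ^ 2 * Real.exp (2 * a * Real.log (ofComplex z).im)

/-- As `a` is real, `|e^(iaw)|` depends only on `Im w = -log y`, and `t` drops out. -/
lemma norm_differential_sq (a : ℚ) (F : ℍ → ℂ) (z : ℍ) (t : ℝ) :
    ‖differential a F (unitTangent (z, t))‖ ^ 2 = normSq a F z := by
  rw [differential, norm_mul, Complex.norm_exp, mul_pow, ← Real.exp_nat_mul, normSq]
  simp [unitTangent]
  left
  ring

lemma perturbedForm_eq (a : ℚ) (F : ℍ → ℂ) (ε : ℝ) :
    perturbedForm a F ε = scaledForm (fun z => 1 + ε * normSq a F z) := by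
  funext m
  rw [perturbedForm, scaledForm, normSqForm, norm_differential_sq]
  simp only [normSq, Function.comp_apply, ofComplex_apply]

lemma normSq_invariant {Γ : Subgroup (Equiv.Perm (ℍ × ℂ))} (hΓ : Γ ≤ SLTilde) {a : ℚ} {F : ℍ → ℂ}
    (hF : IsAutomorphicForm Γ a F) {g : Equiv.Perm (ℍ × ℂ)} (hg : g ∈ Γ) (x : ℍ × ℂ) :
    normSq a F (g x).1 = normSq a F x.1 := by
  obtain ⟨A, -, ℓ, hl, hgA⟩ := mem_labeledLift_iff.1 (hΓ hg)
  obtain ⟨z, w⟩ := x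
  have h := hF.invariant g hg (unitTangent (z, 0))
  rw [apply_unitTangent hl hgA] at h
  rw [hgA, ← norm_differential_sq a F z 0, ← h, norm_differential_sq]

section

variable {a : ℚ} {F : ℍ → ℂ}

lemma contDiffOn_holomorphic {h : ℂ → ℂ} (hh : DifferentiableOn ℂ h halfPlane) :
    ContDiffOn ℝ ∞ h halfPlane :=
  (hh.contDiffOn isOpen_halfPlane).restrict_scalars ℝ

lemma normSq_eqOn :
    Set.EqOn (normSq a F) (fun z => ‖(F ∘ ofComplex) z‖ ^ 2 * Real.exp (2 * a * Real.log z.im))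
      halfPlane := by
  intro z hz
  simp only [normSq]
  rw [ofComplex_apply_of_im_pos hz]
  rfl

lemma contDiffOn_exp_log_im (a : ℝ) :
    ContDiffOn ℝ ∞ (fun z : ℂ => Real.exp (2 * a * Real.log z.im)) halfPlane :=
  Real.contDiff_exp.comp_contDiffOn (contDiffOn_const.mul
    (Complex.imCLM.contDiff.contDiffOn.log fun _ hz => ne_of_gt hz))

lemma contDiffOn_normSq (hF : DifferentiableOn ℂ (F ∘ ofComplex) halfPlane) :
    ContDiffOn ℝ ∞ (normSq a F) halfPlane := by
  refine ContDiffOn.congr ?_ normSq_eqOn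
  exact ((contDiffOn_holomorphic hF).norm_sq ℝ).mul (contDiffOn_exp_log_im a)

lemma normSq_nonneg (z : ℂ) : 0 ≤ normSq a F z := by
  unfold normSq
  positivity

end

lemma piGroup_le (v₁ v₂ v₃ : ℍ) : piGroup v₁ v₂ v₃ ≤ SLTilde := by
  have h : extendedTriangleGroup v₁ v₂ v₃ ≤ SLTilde := by
    intro g hg
    obtain ⟨A, -, h⟩ := mem_labeledLift_iff.1 hg
    exact mem_labeledLift_iff.2 ⟨A, Subgroup.mem_top A, h⟩
  exact Subgroup.commutator_le.2 fun g hg k hk =>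
    SLTilde.mul_mem (SLTilde.mul_mem (SLTilde.mul_mem (h hg) (h hk)) (SLTilde.inv_mem (h hg)))
      (SLTilde.inv_mem (h hk))

/-! ## The Reeb vector field of the perturbed form -/

/-- The coefficient of `F` in the horizontal part of the Reeb vector field. -/
def reebCoeff (a : ℚ) (F : ℍ → ℂ) (ε : ℝ) (z : ℂ) : ℂ :=
  -(2 * Complex.I) * ((ε * z.im ^ 2 * Real.exp (2 * a * Real.log z.im) /
    (1 + ε * normSq a F z) ^ 2 : ℝ) : ℂ) *
    ((starRingEnd ℂ) (deriv (F ∘ ofComplex) z) +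
      Complex.I * ((a / z.im : ℝ) : ℂ) * (starRingEnd ℂ) ((F ∘ ofComplex) z))

/-- The Reeb vector field of the perturbed form. -/
def reebField (a : ℚ) (F : ℍ → ℂ) (ε : ℝ) (z : ℂ) : E :=
  ((F ∘ ofComplex) z * reebCoeff a F ε z,
    1 / (1 + ε * normSq a F z) - ((F ∘ ofComplex) z * reebCoeff a F ε z).re / z.im)

/-- The rotation speed of the linearized Reeb flow at a zero of `F`. -/
def rotSpeed (a : ℚ) (F : ℍ → ℂ) (v : ℍ) : ℝ :=
  2 * v.im ^ 2 * Real.exp (2 * a * Real.log v.im) * ‖deriv (F ∘ ofComplex) v‖ ^ 2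

section

variable {a : ℚ} {F : ℍ → ℂ} {ε : ℝ}

lemma one_add_normSq_pos (hε : 0 ≤ ε) (z : ℂ) : 0 < 1 + ε * normSq a F z := by
  have := normSq_nonneg (a := a) (F := F) z
  positivity

lemma hasFDerivAt_normSq (hF : DifferentiableOn ℂ (F ∘ ofComplex) halfPlane) (z : ℍ) :
    HasFDerivAt (normSq a F) (fderiv ℝ (normSq a F) z) z :=
  hasFDerivAt_of_contDiffOn (contDiffOn_normSq hF) z

lemma fderiv_normSq_apply (hF : DifferentiableOn ℂ (F ∘ ofComplex) halfPlane) (z : ℍ) (u : ℂ) :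
    fderiv ℝ (normSq a F) z u = Real.exp (2 * a * Real.log z.im) *
      (2 * ((starRingEnd ℂ) ((F ∘ ofComplex) z) * (deriv (F ∘ ofComplex) z * u)).re +
        ‖(F ∘ ofComplex) z‖ ^ 2 * (2 * a / z.im * u.im)) := by
  have hz : (z : ℂ) ∈ halfPlane := z.im_pos
  have hd : HasDerivAt (F ∘ ofComplex) (deriv (F ∘ ofComplex) z) z :=
    (hF.differentiableAt (isOpen_halfPlane.mem_nhds hz)).hasDerivAt
  have h1 := (hd.hasFDerivAt.restrictScalars ℝ).norm_sq
  have h2 : HasFDerivAt (fun z : ℂ => Real.exp (2 * a * Real.log z.im)) _ (z : ℂ) :=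
    ((Complex.imCLM.hasFDerivAt.log (x := (z : ℂ)) z.im_pos.ne').const_mul (2 * (a : ℝ))).exp
  have h3 := (h1.mul h2).congr_of_eventuallyEq
    ((normSq_eqOn (a := a) (F := F)).eventuallyEq_of_mem (isOpen_halfPlane.mem_nhds hz))
  rw [h3.fderiv]
  simp [Complex.inner]
  ring

/-- Since `F` is holomorphic, the gradient `f_x + i f_y` is `2 ε y^(2a) F (conj F' + i (a / y) conj
F)`. Splitting off `F` pays off at a zero of `F`, where the derivative of the product needs only the
value of the cofactor `reebCoeff`. -/
lemma isReebVector_reebField (hF : DifferentiableOn ℂ (F ∘ ofComplex) halfPlane) (hε : 0 ≤ ε)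
    (z : ℍ) (t : ℝ) :
    IsReebVector (perturbedForm a F ε) (coord (z, t)) (reebField a F ε z) := by
  have hw := (one_add_normSq_pos (a := a) (F := F) hε z).ne'
  have hy := z.im_pos.ne'
  rw [perturbedForm_eq]
  have hd : HasFDerivAt (fun z => 1 + ε * normSq a F z) (ε • fderiv ℝ (normSq a F) z) (z : ℂ) :=
    ((hasFDerivAt_normSq hF z).const_mul ε).const_add 1
  refine isReebVector_scaledForm t hd hw ?_
  simp only [smul_apply, fderiv_normSq_apply hF, smul_eq_mul]
  have hn : ‖(F ∘ ofComplex) z‖ ^ 2 = ((F ∘ ofComplex) z).re ^ 2 + ((F ∘ ofComplex) z).im ^ 2 := by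
    rw [← Complex.normSq_eq_norm_sq, Complex.normSq_apply]
    ring
  rw [hn]
  unfold reebCoeff
  generalize (F ∘ ofComplex) z = h
  generalize deriv (F ∘ ofComplex) z = h'
  generalize 1 + ε * normSq a F z = w at *
  simp only [coe_im]
  generalize Real.exp (2 * a * Real.log z.im) = e
  generalize z.im = y at *
  generalize (a : ℝ) = b
  generalize hs : ε * y ^ 2 * e / w ^ 2 = s
  generalize hr : b / y = r
  have e1 : ∀ x : ℝ, y ^ 2 * (ε * (e * x)) / w ^ 2 = s * x := by
    intro x; rw [← hs]; ring
  have e2 : 2 * b / y = 2 * r := by rw [← hr]; ring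
  rw [e1, e1, e2]
  apply Complex.ext <;> simp <;> ring

lemma contDiffOn_reebField (hF : DifferentiableOn ℂ (F ∘ ofComplex) halfPlane) (hε : 0 ≤ ε) :
    ContDiffOn ℝ 1 (reebField a F ε) halfPlane ∧ ContDiffOn ℝ 1 (reebCoeff a F ε) halfPlane := by
  have hh : ContDiffOn ℝ ∞ (F ∘ ofComplex) halfPlane := contDiffOn_holomorphic hF
  have hh' : ContDiffOn ℝ ∞ (deriv (F ∘ ofComplex)) halfPlane :=
    contDiffOn_holomorphic (hF.deriv isOpen_halfPlane)
  have him : ContDiffOn ℝ ∞ (fun z : ℂ => z.im) halfPlane := Complex.imCLM.contDiff.contDiffOn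
  have himne : ∀ z ∈ halfPlane, z.im ≠ 0 := fun z hz => ne_of_gt hz
  have hw : ContDiffOn ℝ ∞ (fun z => 1 + ε * normSq a F z) halfPlane :=
    contDiffOn_const.add (contDiffOn_const.mul (contDiffOn_normSq hF))
  have hwne : ∀ z ∈ halfPlane, 1 + ε * normSq a F z ≠ 0 := fun z _ =>
    (one_add_normSq_pos hε z).ne'
  have hQ : ContDiffOn ℝ ∞ (reebCoeff a F ε) halfPlane := by
    refine ContDiffOn.mul (contDiffOn_const.mul (Complex.ofRealCLM.contDiff.comp_contDiffOn
      ((((contDiffOn_const.mul (him.pow 2)).mul (contDiffOn_exp_log_im a))).div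
        (hw.pow 2) fun z hz => pow_ne_zero 2 (hwne z hz)))) ?_
    exact (Complex.conjCLE.contDiff.comp_contDiffOn hh').add
      ((contDiffOn_const.mul (Complex.ofRealCLM.contDiff.comp_contDiffOn
        (contDiffOn_const.div him himne))).mul (Complex.conjCLE.contDiff.comp_contDiffOn hh))
  have hX := hh.mul hQ
  refine ⟨(hX.prodMk ((contDiffOn_const.div hw hwne).sub
    ((Complex.reCLM.contDiff.comp_contDiffOn hX).div him himne))).of_le ?_, hQ.of_le ?_⟩
  all_goals exact_mod_cast le_top

variable {v : ℍ}

lemma reebField_of_zero (hv : F v = 0) : reebField a F ε v = (0, 1) := by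
  simp [reebField, normSq, hv]

/-- At a zero only `F' * conj F' = |F'|²` survives, so the linearization is multiplication by a
purely imaginary number: an infinitesimal clockwise rotation when `ε * rotSpeed` is positive. -/
lemma fst_reebCoeff_of_zero (hv : F v = 0) :
    deriv (F ∘ ofComplex) v * reebCoeff a F ε v = -(Complex.I * (ε * rotSpeed a F v : ℝ)) := by
  have h : deriv (F ∘ ofComplex) v * (starRingEnd ℂ) (deriv (F ∘ ofComplex) v) =
      ((‖deriv (F ∘ ofComplex) v‖ ^ 2 : ℝ) : ℂ) := by
    rw [Complex.mul_conj, Complex.normSq_eq_norm_sq]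
  simp only [reebCoeff, rotSpeed, normSq, Function.comp_apply, ofComplex_apply, hv, coe_im]
  push_cast at h ⊢
  simp
  linear_combination (2 * Complex.I * (ε * v.im ^ 2 *
    Complex.exp (2 * a * (Real.log v.im : ℂ)))) * h

/-- The derivative of the Reeb vector field at a zero of `F`, where `w` is the rotation speed. -/
def reebDeriv (y w : ℝ) : ℂ →L[ℝ] E :=
  ((-(Complex.I * w)) • ContinuousLinearMap.id ℂ ℂ).restrictScalars ℝ |>.prod
    (-(1 / y) • (Complex.reCLM ∘L
      ((-(Complex.I * w)) • ContinuousLinearMap.id ℂ ℂ).restrictScalars ℝ))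

lemma reebDeriv_apply (y w : ℝ) (u : ℂ) :
    reebDeriv y w u = (-(Complex.I * w) * u, -(1 / y) * (-(Complex.I * w) * u).re) := rfl

lemma hasFDerivAt_reebField (hF : DifferentiableOn ℂ (F ∘ ofComplex) halfPlane) (hε : 0 ≤ ε)
    (hv : F v = 0) :
    HasFDerivAt (reebField a F ε) (reebDeriv v.im (ε * rotSpeed a F v)) v := by
  have hz : (v : ℂ) ∈ halfPlane := v.im_pos
  have hy := v.im_pos.ne'
  have hd : HasDerivAt (F ∘ ofComplex) (deriv (F ∘ ofComplex) v) v :=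
    (hF.differentiableAt (isOpen_halfPlane.mem_nhds hz)).hasDerivAt
  have hv' : (F ∘ ofComplex) v = 0 := by simp [hv]
  have hQ : HasFDerivAt (reebCoeff a F ε) _ (v : ℂ) :=
    (((contDiffOn_reebField (a := a) hF hε).2.contDiffAt
      (isOpen_halfPlane.mem_nhds hz)).differentiableAt (by simp)).hasFDerivAt
  have hX := (hd.hasFDerivAt.restrictScalars ℝ).mul hQ
  -- `|F|²` vanishes to second order at a zero of `F`, so `1 / f` contributes nothing to the
  -- linearization.
  have hn0 : fderiv ℝ (normSq a F) v = 0 := by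
    ext u
    all_goals simp [fderiv_normSq_apply hF, hv]
  have hn := hasFDerivAt_normSq (a := a) hF v
  rw [hn0] at hn
  have hw1 : HasFDerivAt (fun z => 1 + ε * normSq a F z) (0 : ℂ →L[ℝ] ℝ) (v : ℂ) := by
    simpa using (hn.const_mul ε).const_add 1
  have hw : HasFDerivAt (fun z => 1 / (1 + ε * normSq a F z)) (0 : ℂ →L[ℝ] ℝ) (v : ℂ) := by
    have := (hasDerivAt_inv (one_add_normSq_pos (a := a) (F := F) hε v).ne').comp_hasFDerivAt
      (v : ℂ) hw1
    rw [smul_zero] at this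
    exact this.congr_of_eventuallyEq (Filter.Eventually.of_forall fun m => one_div _)
  have him : HasFDerivAt (fun z : ℂ => (z.im)⁻¹) _ (v : ℂ) :=
    (hasDerivAt_inv hy).comp_hasFDerivAt (v : ℂ) Complex.imCLM.hasFDerivAt
  have hre : HasFDerivAt (fun z : ℂ => ((F ∘ ofComplex) z * reebCoeff a F ε z).re) _ (v : ℂ) :=
    HasFDerivAt.comp (g := Complex.re) (v : ℂ) Complex.reCLM.hasFDerivAt hX
  have hall := hX.prodMk (hw.sub (hre.mul him))
  have hκ := fst_reebCoeff_of_zero (a := a) (ε := ε) hv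
  have hfun : reebField a F ε = fun z => ((F ∘ ofComplex) z * reebCoeff a F ε z,
      1 / (1 + ε * normSq a F z) - ((F ∘ ofComplex) z * reebCoeff a F ε z).re * z.im⁻¹) := rfl
  rw [hfun]
  refine hall.congr_fderiv ?_
  refine ContinuousLinearMap.ext fun u => ?_
  rw [reebDeriv_apply, ← hκ]
  simp [hv]
  exact ⟨by ring, Or.inl (by ring)⟩

end

/-! ## The linearized Reeb flow at a zero of `F` -/

/-- The linearized Reeb flow at a fibre of height `y`, where `w` is the rotation speed. -/
def linFlow (y w t : ℝ) : E →L[ℝ] E :=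
  ((Complex.exp (-(Complex.I * w * t)) • ContinuousLinearMap.id ℂ ℂ).restrictScalars ℝ ∘L
    ContinuousLinearMap.fst ℝ ℂ ℝ).prod
  (ContinuousLinearMap.snd ℝ ℂ ℝ - (1 / y) • (Complex.reCLM ∘L
    ((Complex.exp (-(Complex.I * w * t)) • ContinuousLinearMap.id ℂ ℂ).restrictScalars ℝ ∘L
      ContinuousLinearMap.fst ℝ ℂ ℝ - ContinuousLinearMap.fst ℝ ℂ ℝ)))

lemma linFlow_apply (y w t : ℝ) (u : E) :
    linFlow y w t u = (Complex.exp (-(Complex.I * w * t)) * u.1,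
      u.2 - 1 / y * (Complex.exp (-(Complex.I * w * t)) * u.1 - u.1).re) := rfl

lemma linFlow_zero (y w : ℝ) (u : E) : linFlow y w 0 u = u := by
  simp [linFlow_apply]

lemma hasDerivAt_linFlow (y w t : ℝ) (u : E) :
    HasDerivAt (fun s => linFlow y w s u) (reebDeriv y w (linFlow y w t u).1) t := by
  have h1 : HasDerivAt (fun s : ℝ => Complex.exp (-(Complex.I * w * s)) * u.1)
      (-(Complex.I * w) * (Complex.exp (-(Complex.I * w * t)) * u.1)) t := by
    have h2 : HasDerivAt (fun s : ℝ => -(Complex.I * w * s)) (-(Complex.I * w)) t := by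
      have h := ((Complex.ofRealCLM.hasDerivAt (x := t)).const_mul (Complex.I * w)).neg
      rw [Complex.ofRealCLM_apply, Complex.ofReal_one, mul_one] at h
      exact h
    convert! h2.cexp.mul_const u.1 using 1
    ring
  have h3 : HasDerivAt (fun s : ℝ => (Complex.exp (-(Complex.I * w * s)) * u.1 - u.1).re)
      (-(Complex.I * w) * (Complex.exp (-(Complex.I * w * t)) * u.1)).re t :=
    Complex.reCLM.hasFDerivAt.comp_hasDerivAt t (h1.sub_const u.1)
  have h4 := h1.prodMk ((h3.const_mul (1 / y)).const_sub u.2)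
  convert! h4 using 1
  rw [reebDeriv_apply, linFlow_apply, neg_mul (1 / y)]

/-- Near a point `(v, 0)` where the Reeb vector field is vertical, the Reeb flow exists for any
given time, and its linearization is determined by that of the vector field. -/
lemma isLinearizedFlow_linFlow {α : E → E →L[ℝ] ℝ} {R : ℂ → E} (hR : ContDiffOn ℝ 1 R halfPlane)
    (hα : ∀ (z : ℍ) (t : ℝ), IsReebVector α (coord (z, t)) (R z)) {v : ℍ} (hv : R v = (0, 1))
    {w : ℝ} (hd : HasFDerivAt R (reebDeriv v.im w) v) {T : ℝ} (hT : 0 ≤ T) :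
    IsLinearizedFlow α (coord (v, 0)) T (linFlow v.im w) := by
  have hvp : (v : ℂ) ∈ halfPlane := v.im_pos
  obtain ⟨ρ, hρ, hball⟩ := Metric.nhds_basis_closedBall.mem_iff.1
    (isOpen_halfPlane.mem_nhds hvp)
  -- The field is cut off inside the half-plane to become compactly supported, hence bounded and
  -- globally Lipschitz. It is unchanged on the ball of radius `ρ / 2`.
  let χ : ContDiffBump (v : ℂ) := ⟨ρ / 2, ρ, by positivity, by linarith⟩
  set X₀ : ℂ → E := fun z => χ z • R z with hX₀
  have hsupp : HasCompactSupport X₀ := χ.hasCompactSupport.smul_right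
  have hsm : ContDiff ℝ 1 X₀ := by
    refine contDiff_iff_contDiffAt.2 fun z => ?_
    by_cases hz : z ∈ tsupport X₀
    · have hz' : z ∈ halfPlane := by
        apply hball
        have : z ∈ tsupport χ := tsupport_smul_subset_left χ R hz
        rwa [χ.tsupport_eq] at this
      exact χ.contDiffAt.smul (hR.contDiffAt (isOpen_halfPlane.mem_nhds hz'))
    · exact contDiffAt_const.congr_of_eventuallyEq (notMem_tsupport_iff_eventuallyEq.1 hz)
  obtain ⟨K, hK⟩ : ∃ K, LipschitzWith K X₀ :=
    ContDiff.lipschitzWith_of_hasCompactSupport hsupp hsm one_ne_zero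
  obtain ⟨B, hB⟩ := hsm.continuous.bounded_above_of_compact_support hsupp
  set X : E → E := fun m => X₀ m.1 with hX
  have hKX : LipschitzWith K X := by
    have := hK.comp (LipschitzWith.prod_fst (α := ℂ) (β := ℝ))
    rwa [mul_one] at this
  obtain ⟨ψ, hψ⟩ := exists_isFlow hKX (L := B) (fun m => hB m.1) hT
  have hnear : ∀ z ∈ Metric.closedBall (v : ℂ) (ρ / 2), X₀ z = R z := by
    intro z hz
    rw [hX₀]
    simp only
    rw [χ.one_of_mem_closedBall hz, one_smul]
  have hinv : ∀ (x : E) (s : ℝ), X (x + s • ((0, 1) : E)) = X x := by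
    intro x s
    simp [hX]
  have he : X (coord (v, 0)) = (0, 1) := by
    simp only [hX, coord]
    rw [hnear v (Metric.mem_closedBall_self (by positivity)), hv]
  have he' : ∀ s : ℝ, X (coord (v, 0) + s • ((0, 1) : E)) = (0, 1) := fun s => by rw [hinv, he]
  have hA : HasFDerivAt X (reebDeriv v.im w ∘L ContinuousLinearMap.fst ℝ ℂ ℝ) (coord (v, 0)) := by
    have h1 : HasFDerivAt X₀ (reebDeriv v.im w) v := by
      refine hd.congr_of_eventuallyEq ?_
      filter_upwards [Metric.closedBall_mem_nhds (v : ℂ) (by positivity : 0 < ρ / 2)] with z hz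
      exact hnear z hz
    exact HasFDerivAt.comp (f := Prod.fst) (coord (v, 0)) h1 hasFDerivAt_fst
  refine ⟨ψ, ?_, fun t ht => hψ.hasFDerivAt hKX hinv he hA (linFlow_zero _ _)
    (fun u s => hasDerivAt_linFlow _ _ s u) ht⟩
  -- Starting points so close to the fibre stay, by the exponential bound, over the ball where the
  -- cut-off field is the Reeb field during all of `[0, T]`.
  have hU : ∀ᶠ x in 𝓝 (coord (v, 0)), ‖x - coord (v, 0)‖ * Real.exp (K * T) < ρ / 2 := by
    have : Filter.Tendsto (fun x => ‖x - coord (v, 0)‖ * Real.exp (K * T)) (𝓝 (coord (v, 0)))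
        (𝓝 (‖coord (v, 0) - coord (v, 0)‖ * Real.exp (K * T))) :=
      (Continuous.tendsto (by fun_prop) _)
    rw [sub_self, norm_zero, zero_mul] at this
    exact this.eventually_lt_const (by positivity)
  refine ⟨_, hU, fun x hx => ⟨(hψ x).1, fun t ht => ?_⟩⟩
  have hclose : (ψ t x).1 ∈ Metric.closedBall (v : ℂ) (ρ / 2) := by
    rw [mem_closedBall_iff_norm]
    have h1 := hψ.norm_sub_le hKX he' x ht
    have h2 : ‖(ψ t x - (coord (v, 0) + t • ((0, 1) : E))).1‖ ≤ _ := norm_fst_le _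
    have h3 : (ψ t x - (coord (v, 0) + t • ((0, 1) : E))).1 = (ψ t x).1 - v := by
      simp [coord]
    rw [h3] at h2
    refine h2.trans (h1.trans (le_trans ?_ (le_of_lt hx)))
    gcongr
    exact ht.2
  have hmem : (ψ t x).1 ∈ halfPlane :=
    hball (Metric.closedBall_subset_closedBall (by linarith) hclose)
  refine ⟨hmem, R (ψ t x).1, hα ⟨(ψ t x).1, hmem⟩ (ψ t x).2, ?_⟩
  have := (hψ x).2 t ht
  simp only [hX] at this
  rwa [hnear _ hclose] at this

/-! ## Reflections in disc coordinates -/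

lemma sub_conj_ne_zero (v z : ℍ) : (z : ℂ) - (starRingEnd ℂ) (v : ℂ) ≠ 0 := by
  intro h
  have := congrArg Complex.im h
  simp at this
  have h1 := z.im_pos
  have h2 := v.im_pos
  linarith

lemma toDisc_self (v : ℍ) : toDisc v v = 0 := by simp [toDisc]

lemma toDisc_injective (v : ℍ) : Function.Injective (toDisc v) := by
  intro a b h
  have ha := sub_conj_ne_zero v a
  have hb := sub_conj_ne_zero v b
  have hv := sub_conj_ne_zero v v
  rw [toDisc, toDisc, div_eq_div_iff ha hb] at h
  have h2 : ((v : ℂ) - (starRingEnd ℂ) (v : ℂ)) * ((a : ℂ) - b) = 0 := by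
    linear_combination h
  rcases mul_eq_zero.1 h2 with h3 | h3
  · exact absurd h3 hv
  · exact UpperHalfPlane.ext (by linear_combination h3)

lemma norm_toDisc_lt_one (v a : ℍ) : ‖toDisc v a‖ < 1 := by
  rw [toDisc, norm_div, div_lt_one (norm_pos_iff.2 (sub_conj_ne_zero v a))]
  rw [← sq_lt_sq₀ (norm_nonneg _) (norm_nonneg _), ← Complex.normSq_eq_norm_sq,
    ← Complex.normSq_eq_norm_sq, Complex.normSq_apply, Complex.normSq_apply]
  have h1 := a.im_pos
  have h2 := v.im_pos
  simp
  nlinarith [mul_pos h1 h2]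

lemma coe_smul_of_det_neg {σ : GL (Fin 2) ℝ} (h : σ.val.det = -1) (z : ℍ) :
    ((σ • z : ℍ) : ℂ) = (σ 0 0 * (starRingEnd ℂ) (z : ℂ) + σ 0 1) /
      (σ 1 0 * (starRingEnd ℂ) (z : ℂ) + σ 1 1) := by
  have h0 : ¬ 0 < (Matrix.GeneralLinearGroup.det σ).val := by
    rw [show (Matrix.GeneralLinearGroup.det σ).val = -1 from h]
    norm_num
  rw [UpperHalfPlane.coe_smul, UpperHalfPlane.σ, if_neg h0]
  simp [UpperHalfPlane.num, UpperHalfPlane.denom]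

/-- In disc coordinates centred at a fixed point, an orientation-reversing isometry is a reflection
in a line through the origin. -/
lemma exists_toDisc_smul_eq {σ : GL (Fin 2) ℝ} (h : σ.val.det = -1) {v : ℍ} (hv : σ • v = v) :
    ∃ μ : ℂ, ∀ z : ℍ, toDisc v (σ • z) = μ * (starRingEnd ℂ) (toDisc v z) := by
  have hd : ∀ z : ℍ, (σ 1 0 * (z : ℂ) + σ 1 1 : ℂ) ≠ 0 := UpperHalfPlane.denom_ne_zero σ
  have hdc : ∀ z : ℍ, (σ 1 0 * (starRingEnd ℂ) (z : ℂ) + σ 1 1 : ℂ) ≠ 0 := by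
    intro z hz
    apply hd z
    have := congrArg (starRingEnd ℂ) hz
    simpa using this
  refine ⟨(σ 1 0 * (v : ℂ) + σ 1 1) / (σ 1 0 * (starRingEnd ℂ) (v : ℂ) + σ 1 1), fun z => ?_⟩
  have h1 := coe_smul_of_det_neg h z
  have h2 := coe_smul_of_det_neg h v
  rw [hv] at h2
  have h3 := congrArg (starRingEnd ℂ) h2
  simp only [map_div₀, map_add, map_mul, Complex.conj_ofReal, Complex.conj_conj] at h3
  have hdet : (σ 0 0 * σ 1 1 - σ 0 1 * σ 1 0 : ℂ) = -1 := by
    rw [Matrix.det_fin_two] at h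
    exact_mod_cast h
  have e1 : ((σ • z : ℍ) : ℂ) - v = -((starRingEnd ℂ) (z : ℂ) - (starRingEnd ℂ) (v : ℂ)) /
      ((σ 1 0 * (starRingEnd ℂ) (z : ℂ) + σ 1 1) * (σ 1 0 * (starRingEnd ℂ) (v : ℂ) + σ 1 1)) := by
    refine (congrArg₂ (fun x y : ℂ => x - y) h1 h2).trans ?_
    rw [div_sub_div _ _ (hdc z) (hdc v)]
    congr 1
    linear_combination ((starRingEnd ℂ) (z : ℂ) - (starRingEnd ℂ) (v : ℂ)) * hdet
  have e2 : ((σ • z : ℍ) : ℂ) - (starRingEnd ℂ) (v : ℂ) = -((starRingEnd ℂ) (z : ℂ) - (v : ℂ)) /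
      ((σ 1 0 * (starRingEnd ℂ) (z : ℂ) + σ 1 1) * (σ 1 0 * (v : ℂ) + σ 1 1)) := by
    rw [h1, h3, div_sub_div _ _ (hdc z) (hd v)]
    congr 1
    linear_combination ((starRingEnd ℂ) (z : ℂ) - (v : ℂ)) * hdet
  have hzv : (starRingEnd ℂ) (z : ℂ) - (v : ℂ) ≠ 0 := by
    intro h0
    apply sub_conj_ne_zero v z
    have := congrArg (starRingEnd ℂ) h0
    simpa using this
  have hA := hdc z
  have hB := hdc v
  have hC := hd v
  simp only [toDisc, e1, e2, map_div₀, map_sub, Complex.conj_conj]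
  generalize (σ 1 0 * (starRingEnd ℂ) (z : ℂ) + σ 1 1 : ℂ) = A at *
  generalize (σ 1 0 * (starRingEnd ℂ) (v : ℂ) + σ 1 1 : ℂ) = B at *
  generalize (σ 1 0 * (v : ℂ) + σ 1 1 : ℂ) = C at *
  field_simp

/-- The map is `ζ ↦ μ * conj ζ` in the disc, and the fixed point `b` determines `μ`. -/
lemma toDisc_reflection {v b : ℍ} {σ : GL (Fin 2) ℝ} (h : σ.val.det = -1) (hv : σ • v = v)
    (hb : σ • b = b) (hvb : toDisc v b ≠ 0) (z : ℍ) :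
    toDisc v (σ • z) =
      toDisc v b / (starRingEnd ℂ) (toDisc v b) * (starRingEnd ℂ) (toDisc v z) := by
  obtain ⟨μ, hμ⟩ := exists_toDisc_smul_eq h hv
  have h1 := hμ b
  rw [hb] at h1
  have h2 : (starRingEnd ℂ) (toDisc v b) ≠ 0 := by simpa using hvb
  rw [hμ z]
  congr 1
  rw [eq_div_iff h2]
  exact h1.symm

/-- The product of the reflections in two lines through `v` is the rotation by twice the angle. -/
lemma toDisc_reflection_mul {v b c : ℍ} {σ τ : GL (Fin 2) ℝ} (hσ : σ.val.det = -1)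
    (hσv : σ • v = v) (hσb : σ • b = b) (hτ : τ.val.det = -1) (hτv : τ • v = v) (hτc : τ • c = c)
    (hang : orientedAngle v b c ≠ 0) (z : ℍ) :
    toDisc v (τ • σ • z) =
      Complex.exp (Complex.I * (2 * orientedAngle v b c : ℝ)) * toDisc v z := by
  have hb : toDisc v b ≠ 0 := fun h => hang (by simp [orientedAngle, h])
  have hc : toDisc v c ≠ 0 := fun h => hang (by simp [orientedAngle, h])
  rw [toDisc_reflection hτ hτv hτc hc, toDisc_reflection hσ hσv hσb hb]
  have hb' : (starRingEnd ℂ) (toDisc v b) ≠ 0 := by simpa using hb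
  have hc' : (starRingEnd ℂ) (toDisc v c) ≠ 0 := by simpa using hc
  -- A complex number `u` of argument `θ` satisfies `u = e^(2iθ) * conj u`; this is where the angle
  -- doubles.
  have key : toDisc v c / toDisc v b = Complex.exp (Complex.I * (2 * orientedAngle v b c : ℝ)) *
      (starRingEnd ℂ) (toDisc v c / toDisc v b) := by
    have h1 := Complex.norm_mul_exp_arg_mul_I (toDisc v c / toDisc v b)
    have h2 := congrArg (starRingEnd ℂ) h1
    rw [map_mul, ← Complex.exp_conj] at h2
    simp only [map_mul, Complex.conj_ofReal, Complex.conj_I] at h2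
    rw [← h2]
    conv_lhs => rw [← h1]
    rw [mul_left_comm, ← Complex.exp_add, orientedAngle]
    congr 2
    push_cast
    ring
  rw [map_div₀, div_eq_iff hb] at key
  simp only [map_mul, map_div₀, Complex.conj_conj]
  field_simp
  field_simp at key
  linear_combination (toDisc v z) * key

/-- Existence of the reflection in the geodesic through `a` and `b`. -/
lemma exists_isReflection {a b : ℍ} (hab : a ≠ b) :
    ∃ σ : GL (Fin 2) ℝ, IsReflection a b σ ∧ σ * σ = 1 := by
  -- The geodesic through `a` and `b` is `γ |z|² - 2 α x - β = 0`, and the trace-zero matrix with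
  -- rows `(α, β)`, `(γ, -α)` fixes precisely the points satisfying this equation. The positivity
  -- below is `α² + β γ = |a - b|² |a - conj b|²`.
  set γ : ℝ := 2 * (a.re - b.re) with hγ
  set α : ℝ := (a.re ^ 2 + a.im ^ 2) - (b.re ^ 2 + b.im ^ 2) with hα
  set β : ℝ := 2 * (a.re * (b.re ^ 2 + b.im ^ 2) - b.re * (a.re ^ 2 + a.im ^ 2)) with hβ
  have hpos : 0 < α ^ 2 + β * γ := by
    have h1 : α ^ 2 + β * γ = ((a.re - b.re) ^ 2 + (a.im - b.im) ^ 2) *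
        ((a.re - b.re) ^ 2 + (a.im + b.im) ^ 2) := by
      rw [hγ, hα, hβ]; ring
    rw [h1]
    have ha := a.im_pos
    have hb := b.im_pos
    refine mul_pos ?_ (by positivity)
    by_contra hle
    apply hab
    have h2 : a.re - b.re = 0 := by nlinarith [sq_nonneg (a.re - b.re), sq_nonneg (a.im - b.im)]
    have h3 : a.im - b.im = 0 := by nlinarith [sq_nonneg (a.re - b.re), sq_nonneg (a.im - b.im)]
    exact UpperHalfPlane.ext (Complex.ext (by simpa using sub_eq_zero.1 h2)
      (by simpa using sub_eq_zero.1 h3))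
  set n := Real.sqrt (α ^ 2 + β * γ) with hn
  have hn2 : n ^ 2 = α ^ 2 + β * γ := Real.sq_sqrt hpos.le
  have hn0 : n ≠ 0 := (Real.sqrt_pos.2 hpos).ne'
  set M : Matrix (Fin 2) (Fin 2) ℝ := !![α / n, β / n; γ / n, -(α / n)] with hM
  have hdet : M.det = -1 := by
    rw [hM, Matrix.det_fin_two_of]
    field_simp
    linarith
  set σ : GL (Fin 2) ℝ := Matrix.GeneralLinearGroup.mkOfDetNeZero M (by rw [hdet]; norm_num)
    with hσ
  have hσM : σ.val = M := rfl
  have hfix : ∀ z : ℍ, γ * (z.re ^ 2 + z.im ^ 2) - 2 * α * z.re - β = 0 → σ • z = z := by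
    intro z hz
    have hd : σ.val.det = -1 := by rw [hσM, hdet]
    apply UpperHalfPlane.ext
    rw [coe_smul_of_det_neg hd]
    have hden : (σ 1 0 * (starRingEnd ℂ) (z : ℂ) + σ 1 1 : ℂ) ≠ 0 := by
      intro h0
      apply UpperHalfPlane.denom_ne_zero σ z
      have := congrArg (starRingEnd ℂ) h0
      simpa [UpperHalfPlane.denom] using this
    rw [div_eq_iff hden]
    have e00 : σ 0 0 = α / n := rfl
    have e01 : σ 0 1 = β / n := rfl
    have e10 : σ 1 0 = γ / n := rfl
    have e11 : σ 1 1 = -(α / n) := rfl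
    rw [e00, e01, e10, e11]
    apply Complex.ext
    · simp
      field_simp
      linarith
    · simp
      field_simp
      ring
  refine ⟨σ, ⟨hdet, hfix a ?_, hfix b ?_⟩, ?_⟩
  · rw [hγ, hα, hβ]; ring
  · rw [hγ, hα, hβ]; ring
  · apply Units.ext
    rw [Units.val_mul, hσM, Units.val_one, hM, Matrix.mul_fin_two, Matrix.one_fin_two]
    have h1 : α / n * (α / n) + β / n * (γ / n) = 1 := by
      field_simp
      linarith
    congr 1
    ext i j
    fin_cases i <;> fin_cases j <;> simp <;> linarith

lemma exists_SL_eq_mul {σ τ : GL (Fin 2) ℝ} (hσ : σ.val.det = -1) (hτ : τ.val.det = -1) :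
    ∃ A : SL(2, ℝ), Matrix.SpecialLinearGroup.toGL A = τ * σ ∧ ∀ z : ℍ, A • z = τ • σ • z := by
  refine ⟨⟨(τ * σ).val, ?_⟩, ?_, ?_⟩
  · rw [Units.val_mul, Matrix.det_mul, hσ, hτ]; norm_num
  · apply Units.ext; rfl
  · intro z
    rw [← mul_smul]
    rfl

/-! ## Labeled rotations -/

/-- The labeled map with underlying Moebius transformation `A` and label `ℓ`. -/
def labelPerm (A : SL(2, ℝ)) (ℓ : ℍ → ℂ) : Equiv.Perm (ℍ × ℂ) where
  toFun x := (A • x.1, x.2 + ℓ x.1)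
  invFun x := (A⁻¹ • x.1, x.2 - ℓ (A⁻¹ • x.1))
  left_inv x := by simp
  right_inv x := by simp

lemma labelPerm_apply (A : SL(2, ℝ)) (ℓ : ℍ → ℂ) (z : ℍ) (w : ℂ) :
    labelPerm A ℓ (z, w) = (A • z, w + ℓ z) := rfl

/-- A branch of the logarithm of `z - conj v` on the upper half-plane. -/
def logSub (v : ℍ) (z : ℂ) : ℂ := Complex.log (z - (starRingEnd ℂ) (v : ℂ))

lemma sub_conj_mem_slitPlane (v z : ℍ) : (z : ℂ) - (starRingEnd ℂ) (v : ℂ) ∈ Complex.slitPlane := by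
  refine Complex.mem_slitPlane_iff.2 (Or.inr ?_)
  have h1 := z.im_pos
  have h2 := v.im_pos
  simp
  linarith

lemma hasDerivAt_logSub (v z : ℍ) :
    HasDerivAt (logSub v) (1 / ((z : ℂ) - (starRingEnd ℂ) (v : ℂ))) z :=
  ((hasDerivAt_id (z : ℂ)).sub_const _).clog (sub_conj_mem_slitPlane v z)

lemma exp_logSub (v z : ℍ) :
    Complex.exp (logSub v z) = (z : ℂ) - (starRingEnd ℂ) (v : ℂ) :=
  Complex.exp_log (sub_conj_ne_zero v z)

/-- The label of the rotation `A` by the angle `θ` about `v`. -/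
def rotLabel (v : ℍ) (A : SL(2, ℝ)) (θ : ℝ) (z : ℍ) : ℂ :=
  θ - 2 * Complex.I * (logSub v (A • z : ℍ) - logSub v z)

/-- Differentiating the rotation in the disc coordinate gives `A'(z) = e^(iθ) ((A z - conj v) / (z -
conj v))²`. Both factors stay in the upper half-plane, so their logarithms are single-valued there.
At the centre the label equals `θ`. -/
lemma isLabel_rotLabel {v : ℍ} {A : SL(2, ℝ)} {θ : ℝ}
    (h : ∀ z, toDisc v (A • z) = Complex.exp (Complex.I * θ) * toDisc v z) :
    IsLabel A (rotLabel v A θ) where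
  continuous := by
    have hlog : Continuous fun z : ℍ => logSub v z := by
      refine continuous_iff_continuousAt.2 fun z => ?_
      exact (hasDerivAt_logSub v z).continuousAt.comp
        (f := fun z : ℍ => (z : ℂ)) UpperHalfPlane.continuous_coe.continuousAt
    exact continuous_const.sub (continuous_const.mul
      ((hlog.comp (continuous_const_smul A)).sub hlog))
  exp_eq := by
    intro z
    set c := (starRingEnd ℂ) (v : ℂ) with hc
    have hd : ∀ w : ℍ, HasDerivAt (fun x : ℂ => (x - v) / (x - c)) ((v - c) / (w - c) ^ 2) w := by
      intro w
      have hw : (w : ℂ) - c ≠ 0 := sub_conj_ne_zero v w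
      convert! ((hasDerivAt_id (w : ℂ)).sub_const (v : ℂ)).div
        ((hasDerivAt_id (w : ℂ)).sub_const c) hw using 1
      simp
    have h1 : HasDerivAt (fun x : ℂ => (((A • ofComplex x : ℍ) : ℂ) - v) /
        (((A • ofComplex x : ℍ) : ℂ) - c))
        ((v - c) / (((A • z : ℍ) : ℂ) - c) ^ 2 * (1 / den A z ^ 2)) z := by
      have h2 := hd (A • z)
      have h3 := hasDerivAt_moebius A z
      exact HasDerivAt.comp (z : ℂ) (h₂ := fun x : ℂ => (x - v) / (x - c)) (by simpa using h2) h3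
    have h2 : HasDerivAt (fun x : ℂ => (((A • ofComplex x : ℍ) : ℂ) - v) /
        (((A • ofComplex x : ℍ) : ℂ) - c))
        (Complex.exp (Complex.I * θ) * ((v - c) / ((z : ℂ) - c) ^ 2)) z := by
      refine ((hd z).const_mul _).congr_of_eventuallyEq ?_
      filter_upwards [isOpen_halfPlane.mem_nhds z.im_pos] with x hx
      have := h (ofComplex x)
      rw [toDisc, toDisc, ← hc, ofComplex_apply_of_im_pos hx] at this
      rw [ofComplex_apply_of_im_pos hx]
      exact this
    have h3 := h1.unique h2
    have hA : ((A • z : ℍ) : ℂ) - c ≠ 0 := sub_conj_ne_zero v (A • z)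
    have hz : (z : ℂ) - c ≠ 0 := sub_conj_ne_zero v z
    have hv : (v : ℂ) - c ≠ 0 := sub_conj_ne_zero v v
    have hden := den_ne_zero A z
    have h4 : Complex.I * rotLabel v A θ z = Complex.I * θ + 2 * logSub v (A • z : ℍ) -
        2 * logSub v z := by
      rw [rotLabel]
      linear_combination (-2 * (logSub v (A • z : ℍ) - logSub v z)) * Complex.I_mul_I
    have h5 : ∀ w : ℍ, Complex.exp (2 * logSub v w) = ((w : ℂ) - c) ^ 2 := by
      intro w
      rw [← exp_logSub, ← Complex.exp_nat_mul]
      norm_num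
    rw [h4, Complex.exp_sub, Complex.exp_add, h5, h5]
    field_simp
    field_simp at h3
    linear_combination -h3

/-- The labeled rotation by the angle `θ` about `v`. -/
def labeledRot (v : ℍ) (A : SL(2, ℝ)) (θ : ℝ) : Equiv.Perm (ℍ × ℂ) := labelPerm A (rotLabel v A θ)

/-- The central translation by `τ` in the second factor. -/
def shift (τ : ℂ) : Equiv.Perm (ℍ × ℂ) := labelPerm 1 fun _ => τ

lemma shift_apply (τ : ℂ) (z : ℍ) (w : ℂ) : shift τ (z, w) = (z, w + τ) := by
  rw [shift, labelPerm_apply, one_smul]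

lemma shift_pow (τ : ℂ) (k : ℕ) : shift τ ^ k = shift (k * τ) := by
  induction k with
  | zero =>
    ext1 ⟨z, w⟩
    simp [shift_apply]
  | succ k ih =>
    ext1 ⟨z, w⟩
    rw [pow_succ, ih, Equiv.Perm.mul_apply, shift_apply, shift_apply, shift_apply]
    congr 1
    push_cast
    ring

lemma labeledRot_mem {S : Subgroup SL(2, ℝ)} {v : ℍ} {A : SL(2, ℝ)} {θ : ℝ} (hA : A ∈ S)
    (h : ∀ z, toDisc v (A • z) = Complex.exp (Complex.I * θ) * toDisc v z) :
    labeledRot v A θ ∈ labeledLift S :=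
  mem_labeledLift_iff.2 ⟨A, hA, _, isLabel_rotLabel h, fun _ _ => rfl⟩

lemma labeledRot_pow_apply (v : ℍ) (A : SL(2, ℝ)) (θ : ℝ) (k : ℕ) (z : ℍ) (w : ℂ) :
    (labeledRot v A θ ^ k) (z, w) =
      (A ^ k • z, w + (k * θ - 2 * Complex.I * (logSub v (A ^ k • z : ℍ) - logSub v z))) := by
  induction k with
  | zero => simp
  | succ k ih =>
    rw [pow_succ', Equiv.Perm.mul_apply, ih, labeledRot, labelPerm_apply, rotLabel, smul_smul,
      ← pow_succ']
    congr 1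
    push_cast
    ring

lemma labeledRot_pow_apply_center {v : ℍ} {A : SL(2, ℝ)} (hv : A • v = v) (θ : ℝ) (k : ℕ) (w : ℂ) :
    (labeledRot v A θ ^ k) (v, w) = (v, w + k * θ) := by
  have hk : A ^ k • v = v := by
    induction k with
    | zero => simp
    | succ k ih => rw [pow_succ, mul_smul, hv, ih]
  rw [labeledRot_pow_apply, hk]
  simp

lemma smul_center {v : ℍ} {A : SL(2, ℝ)} {c : ℂ} (h : ∀ z, toDisc v (A • z) = c * toDisc v z) :
    A • v = v := by
  apply toDisc_injective v
  rw [h, toDisc_self, mul_zero]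

/-- A labeled rotation by `2 π / p` is a `p`-th root of the central translation by `2 π`. -/
lemma labeledRot_pow_eq {v : ℍ} {A : SL(2, ℝ)} {p : ℕ} (hp : 0 < p)
    (h : ∀ z, toDisc v (A • z) =
      Complex.exp (Complex.I * (2 * (Real.pi / p) : ℝ)) * toDisc v z) :
    labeledRot v A (2 * (Real.pi / p)) ^ p = shift (2 * Real.pi) := by
  have hp0 : (p : ℂ) ≠ 0 := by exact_mod_cast hp.ne'
  have hpow : ∀ (k : ℕ) (z : ℍ), toDisc v (A ^ k • z) =
      Complex.exp (Complex.I * (2 * (Real.pi / p) : ℝ)) ^ k * toDisc v z := by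
    intro k z
    induction k with
    | zero => simp
    | succ k ih => rw [pow_succ', mul_smul, h, ih, pow_succ]; ring
  have h1 : Complex.exp (Complex.I * (2 * (Real.pi / p) : ℝ)) ^ p = 1 := by
    rw [← Complex.exp_nat_mul, ← Complex.exp_two_pi_mul_I]
    congr 1
    push_cast
    field_simp
  have hid : ∀ z : ℍ, A ^ p • z = z := by
    intro z
    apply toDisc_injective v
    rw [hpow, h1, one_mul]
  ext1 ⟨z, w⟩
  rw [labeledRot_pow_apply, hid, shift_apply]
  congr 1
  push_cast
  field_simp
  ring

lemma isPreconnected_halfPlane : IsPreconnected halfPlane :=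
  (convex_halfSpace_im_gt 0).isPreconnected

lemma eq_of_hasDerivAt_zero {f : ℂ → ℂ} (hf : ∀ z : ℍ, HasDerivAt f 0 z) (z w : ℍ) :
    f z = f w :=
  isOpen_halfPlane.is_const_of_deriv_eq_zero isPreconnected_halfPlane
    (fun x hx => (hf ⟨x, hx⟩).differentiableAt.differentiableWithinAt)
    (fun x hx => (hf ⟨x, hx⟩).deriv) z.im_pos w.im_pos

/-- The difference of two branches `logSub` in terms of the disc coordinate. -/
lemma logSub_sub_logSub (v b x y : ℍ) :
    (logSub b x - logSub v x) - (logSub b y - logSub v y) =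
      Complex.log (1 - (starRingEnd ℂ) (toDisc v b) * toDisc v x) -
        Complex.log (1 - (starRingEnd ℂ) (toDisc v b) * toDisc v y) := by
  set cv := (starRingEnd ℂ) (v : ℂ) with hcv
  set cb := (starRingEnd ℂ) (b : ℂ) with hcb
  have hvb : (v : ℂ) - cb ≠ 0 := sub_conj_ne_zero b v
  have hvv : (v : ℂ) - cv ≠ 0 := sub_conj_ne_zero v v
  set C := ((v : ℂ) - cv) / (v - cb) with hC
  have hC0 : C ≠ 0 := div_ne_zero hvv hvb
  -- The right side is a constant times the quotient whose logarithm is sought, while the left side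
  -- has positive real part. So its principal logarithm is holomorphic and differs from `logSub b -
  -- logSub v` by a constant.
  have hh : ∀ z : ℍ, 1 - (starRingEnd ℂ) (toDisc v b) * toDisc v z =
      C * (z - cb) / (z - cv) := by
    intro z
    have h1 : (z : ℂ) - cv ≠ 0 := sub_conj_ne_zero v z
    have h2 : cb - v ≠ 0 := by rw [← neg_sub]; exact neg_ne_zero.2 hvb
    have hcc : (starRingEnd ℂ) cv = v := Complex.conj_conj _
    simp only [toDisc, map_div₀, map_sub, ← hcv, ← hcb, hcc]
    rw [hC]
    field_simp
    ring
  have hre : ∀ z : ℍ, C * (z - cb) / (z - cv) ∈ Complex.slitPlane := by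
    intro z
    rw [← hh z]
    refine Complex.mem_slitPlane_iff.2 (Or.inl ?_)
    have h1 : ‖(starRingEnd ℂ) (toDisc v b) * toDisc v z‖ < 1 := by
      rw [norm_mul, Complex.norm_conj]
      exact mul_lt_one_of_nonneg_of_lt_one_left (norm_nonneg _) (norm_toDisc_lt_one v b)
        (norm_toDisc_lt_one v z).le
    have h2 := (Complex.re_le_norm _).trans_lt h1
    rw [Complex.sub_re, Complex.one_re]
    linarith
  have hder : ∀ z : ℍ, HasDerivAt
      (fun z : ℂ => logSub b z - logSub v z - Complex.log (C * (z - cb) / (z - cv))) 0 z := by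
    intro z
    have h1 : (z : ℂ) - cv ≠ 0 := sub_conj_ne_zero v z
    have h2 : (z : ℂ) - cb ≠ 0 := sub_conj_ne_zero b z
    have h3 : HasDerivAt (fun z : ℂ => C * (z - cb) / (z - cv))
        ((C * (z - cv) - C * (z - cb)) / (z - cv) ^ 2) z := by
      convert! (((hasDerivAt_id (z : ℂ)).sub_const cb).const_mul C).div
        ((hasDerivAt_id (z : ℂ)).sub_const cv) h1 using 1
      simp
    convert! ((hasDerivAt_logSub b z).sub (hasDerivAt_logSub v z)).sub (h3.clog (hre z)) using 1
    rw [← hcv, ← hcb]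
    field_simp
    ring
  have := eq_of_hasDerivAt_zero hder x y
  rw [hh, hh]
  linear_combination this

/-! ## The relation between the three labeled rotations of a triangle -/

/-- The contribution of the middle rotation to the label of the product of the three rotations. -/
lemma logSub_reflection {v b x y : ℍ} (hb : toDisc v b ≠ 0)
    (hxy : toDisc v x = toDisc v b / (starRingEnd ℂ) (toDisc v b) * (starRingEnd ℂ) (toDisc v y))
    (hang : 0 < orientedAngle v b y) (hang' : orientedAngle v b y < Real.pi) :
    ∃ η : ℝ, 0 < η ∧ η < 2 * Real.pi ∧
      -(2 * Complex.I) * ((logSub b x - logSub v x) - (logSub b y - logSub v y)) = η := by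
  have hb' : (starRingEnd ℂ) (toDisc v b) ≠ 0 := by simpa using hb
  set h := 1 - (starRingEnd ℂ) (toDisc v b) * toDisc v y with hh
  -- The reflection in the line through `v` and `b` conjugates this quantity, so the difference of
  -- logarithms is `-2 i arg h`. As `h` lies in the fourth quadrant, `η = -4 arg h` is between `0`
  -- and `2 π`.
  have hx : 1 - (starRingEnd ℂ) (toDisc v b) * toDisc v x = (starRingEnd ℂ) h := by
    rw [hxy, hh]
    simp only [map_sub, map_mul, map_one, Complex.conj_conj]
    field_simp
  have hre : 0 < h.re := by
    have h1 : ‖(starRingEnd ℂ) (toDisc v b) * toDisc v y‖ < 1 := by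
      rw [norm_mul, Complex.norm_conj]
      exact mul_lt_one_of_nonneg_of_lt_one_left (norm_nonneg _) (norm_toDisc_lt_one v b)
        (norm_toDisc_lt_one v y).le
    have h2 := (Complex.re_le_norm _).trans_lt h1
    rw [hh, Complex.sub_re, Complex.one_re]
    linarith
  have him : h.im < 0 := by
    have h1 : 0 < (toDisc v y / toDisc v b).im := by
      have h0 := Complex.arg_nonneg_iff.1 (show 0 ≤ (toDisc v y / toDisc v b).arg from hang.le)
      refine lt_of_le_of_ne h0 fun h0 => ?_
      rcases le_or_gt 0 (toDisc v y / toDisc v b).re with h3 | h3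
      · exact hang.ne' (Complex.arg_eq_zero_iff.2 ⟨h3, h0.symm⟩)
      · exact hang'.ne (Complex.arg_eq_pi_iff.2 ⟨h3, h0.symm⟩)
    have h2 : (starRingEnd ℂ) (toDisc v b) * toDisc v y =
        (Complex.normSq (toDisc v b) : ℂ) * (toDisc v y / toDisc v b) := by
      rw [← Complex.mul_conj]
      field_simp
    rw [hh, h2, Complex.sub_im, Complex.one_im, Complex.im_ofReal_mul]
    have := Complex.normSq_pos.2 hb
    nlinarith [mul_pos this h1]
  have harg1 : h.arg < 0 := Complex.arg_neg_iff.2 him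
  have harg2 : |h.arg| < Real.pi / 2 := Complex.abs_arg_lt_pi_div_two_iff.2 (Or.inl hre)
  have harg3 := (abs_lt.1 harg2).1
  refine ⟨-4 * h.arg, by linarith, by linarith, ?_⟩
  rw [logSub_sub_logSub, hx, ← hh, Complex.log_conj _ (by linarith [Real.pi_pos])]
  have h3 : (starRingEnd ℂ) (Complex.log h) - Complex.log h = -(2 * Complex.I * h.arg) := by
    rw [← Complex.log_im]
    apply Complex.ext <;> simp
    ring
  rw [h3]
  push_cast
  linear_combination (4 * (h.arg : ℂ)) * Complex.I_mul_I

lemma IsLabel.comp {A B : SL(2, ℝ)} {ℓ k : ℍ → ℂ} (hA : IsLabel A ℓ) (hB : IsLabel B k) :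
    IsLabel (A * B) fun z => ℓ (B • z) + k z where
  continuous := (hA.continuous.comp (continuous_const_smul B)).add hB.continuous
  exp_eq z := by
    have h := deriv_moebius_mul A B z
    rw [(hasDerivAt_moebius (A * B) z).deriv, (hasDerivAt_moebius A (B • z)).deriv,
      (hasDerivAt_moebius B z).deriv] at h
    rw [mul_add, Complex.exp_add, hA.exp_eq, hB.exp_eq, h]

/-- A label of a map that acts trivially is a constant multiple of `2 π`. -/
lemma IsLabel.exists_eq {A : SL(2, ℝ)} {ℓ : ℍ → ℂ} (h : IsLabel A ℓ) (hA : ∀ z : ℍ, A • z = z) :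
    ∃ k : ℤ, ∀ z, ℓ z = 2 * Real.pi * k := by
  have hder : ∀ z : ℍ, HasDerivAt (ℓ ∘ ofComplex) 0 z := by
    have hone : ∀ z : ℍ, 1 / den A z ^ 2 = 1 := by
      intro z
      have h1 := hasDerivAt_moebius A z
      have h2 : HasDerivAt (fun x : ℂ => ((A • ofComplex x : ℍ) : ℂ)) 1 z := by
        refine (hasDerivAt_id (z : ℂ)).congr_of_eventuallyEq ?_
        simp only [hA]
        exact eventuallyEq_coe_comp_ofComplex z.im_pos
      exact h1.unique h2
    have hc : (A 1 0 : ℂ) = 0 := by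
      have h1 := hone ⟨Complex.I, by simp⟩
      have h2 := hone ⟨1 + Complex.I, by simp⟩
      have h3 := hone ⟨2 + Complex.I, by simp⟩
      rw [one_div, inv_eq_one] at h1 h2 h3
      -- Second difference of `(c z + d)² = 1` at `i`, `1 + i`, `2 + i`.
      have h4 : 2 * (A 1 0 : ℂ) ^ 2 = 0 := by
        simp only [den] at h1 h2 h3
        linear_combination h1 - 2 * h2 + h3
      simpa using h4
    intro z
    have := h.hasDerivAt z
    rwa [hc, mul_zero, zero_div] at this
  have hI : Complex.exp (Complex.I * ℓ I) = 1 := by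
    have h1 := h.exp_eq I
    have h2 := hasDerivAt_moebius A I
    have h3 : HasDerivAt (fun x : ℂ => ((A • ofComplex x : ℍ) : ℂ)) 1 (I : ℍ) := by
      refine (hasDerivAt_id ((I : ℍ) : ℂ)).congr_of_eventuallyEq ?_
      simp only [hA]
      exact eventuallyEq_coe_comp_ofComplex I.im_pos
    rw [h1, h2.unique h3]
  obtain ⟨k, hk⟩ := Complex.exp_eq_one_iff.1 hI
  refine ⟨k, fun z => ?_⟩
  have h1 := eq_of_hasDerivAt_zero hder z I
  simp only [Function.comp_apply, ofComplex_apply] at h1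
  rw [h1]
  apply mul_left_cancel₀ Complex.I_ne_zero
  rw [hk]
  ring

/-- The abelianized relation of a centrally extended triangle group. -/
lemma mem_commutator_of_relations {G : Type*} [Group G] {x₁ x₂ x₃ c : G} {q r : ℕ}
    (h₂ : x₂ ^ q = c) (h₃ : x₃ ^ r = c) (h : x₁ * x₂ * x₃ = c) :
    c ^ (q * r) * (x₁ ^ (q * r) * c ^ r * c ^ q)⁻¹ ∈ commutator G := by
  rw [← Abelianization.ker_of, MonoidHom.mem_ker, map_mul, map_inv, mul_inv_eq_one]
  conv_lhs => rw [← h]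
  -- In the abelianization `x₂^(qr) = c^r` and `x₃^(qr) = c^q`.
  simp only [map_pow, map_mul, mul_pow]
  congr 1
  · congr 1
    rw [pow_mul, ← map_pow, h₂]
  · rw [mul_comm q r, pow_mul, ← map_pow, h₃]

/-- The rotations `A₁, A₂, A₃` about the vertices of the triangle, and their relation. -/
lemma exists_rotations {p q r : ℕ} (hp : 0 < p) (hq : 0 < q) (hr : 0 < r) {v₁ v₂ v₃ : ℍ}
    (hv : IsTriangle p q r v₁ v₂ v₃) :
    ∃ A₁ ∈ triangleGroup v₁ v₂ v₃, ∃ A₂ ∈ triangleGroup v₁ v₂ v₃, ∃ A₃ ∈ triangleGroup v₁ v₂ v₃,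
      (∀ z, toDisc v₁ (A₁ • z) =
        Complex.exp (Complex.I * (2 * (Real.pi / p) : ℝ)) * toDisc v₁ z) ∧
      (∀ z, toDisc v₂ (A₂ • z) =
        Complex.exp (Complex.I * (2 * (Real.pi / q) : ℝ)) * toDisc v₂ z) ∧
      (∀ z, toDisc v₃ (A₃ • z) =
        Complex.exp (Complex.I * (2 * (Real.pi / r) : ℝ)) * toDisc v₃ z) ∧
      (∀ z : ℍ, A₁ • A₂ • A₃ • z = z) ∧ toDisc v₁ v₂ ≠ 0 ∧
      toDisc v₁ (A₂ • v₃) =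
        toDisc v₁ v₂ / (starRingEnd ℂ) (toDisc v₁ v₂) * (starRingEnd ℂ) (toDisc v₁ v₃) := by
  have hang : ∀ n : ℕ, 0 < n → Real.pi / n ≠ 0 := fun n hn =>
    div_ne_zero Real.pi_ne_zero (by exact_mod_cast hn.ne')
  have h1 : orientedAngle v₁ v₂ v₃ ≠ 0 := by rw [hv.angle₁]; exact hang p hp
  have h2 : orientedAngle v₂ v₃ v₁ ≠ 0 := by rw [hv.angle₂]; exact hang q hq
  have h3 : orientedAngle v₃ v₁ v₂ ≠ 0 := by rw [hv.angle₃]; exact hang r hr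
  have hne : ∀ {u a b : ℍ}, orientedAngle u a b ≠ 0 → u ≠ a ∧ u ≠ b ∧ toDisc u a ≠ 0 := by
    intro u a b h
    have ha : toDisc u a ≠ 0 := fun h0 => h (by simp [orientedAngle, h0])
    have hb : toDisc u b ≠ 0 := fun h0 => h (by simp [orientedAngle, h0])
    exact ⟨fun e => ha (e ▸ toDisc_self u), fun e => hb (e ▸ toDisc_self u), ha⟩
  obtain ⟨σ, ⟨hσd, hσ2, hσ3⟩, hσσ⟩ := exists_isReflection (hne h2).1
  obtain ⟨τ, ⟨hτd, hτ3, hτ1⟩, hττ⟩ := exists_isReflection (hne h3).1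
  obtain ⟨ρ, ⟨hρd, hρ1, hρ2⟩, hρρ⟩ := exists_isReflection (hne h1).1
  have mσ : σ ∈ fullTriangleGroup v₁ v₂ v₃ :=
    Subgroup.subset_closure (Or.inl ⟨hσd, hσ2, hσ3⟩)
  have mτ : τ ∈ fullTriangleGroup v₁ v₂ v₃ :=
    Subgroup.subset_closure (Or.inr (Or.inl ⟨hτd, hτ3, hτ1⟩))
  have mρ : ρ ∈ fullTriangleGroup v₁ v₂ v₃ :=
    Subgroup.subset_closure (Or.inr (Or.inr ⟨hρd, hρ1, hρ2⟩))
  -- With `A₁ = τ ρ`, `A₂ = ρ σ`, `A₃ = σ τ` the product telescopes to the identity, since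
  -- reflections are involutions.
  obtain ⟨A₁, hA₁, hA₁'⟩ := exists_SL_eq_mul hρd hτd
  obtain ⟨A₂, hA₂, hA₂'⟩ := exists_SL_eq_mul hσd hρd
  obtain ⟨A₃, hA₃, hA₃'⟩ := exists_SL_eq_mul hτd hσd
  refine ⟨A₁, ?_, A₂, ?_, A₃, ?_, ?_, ?_, ?_, ?_, (hne h1).2.2, ?_⟩
  · rw [triangleGroup, Subgroup.mem_comap, hA₁]
    exact mul_mem mτ mρ
  · rw [triangleGroup, Subgroup.mem_comap, hA₂]
    exact mul_mem mρ mσ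
  · rw [triangleGroup, Subgroup.mem_comap, hA₃]
    exact mul_mem mσ mτ
  · intro z
    rw [hA₁', toDisc_reflection_mul hρd hρ1 hρ2 hτd hτ1 hτ3 h1, hv.angle₁]
  · intro z
    rw [hA₂', toDisc_reflection_mul hσd hσ2 hσ3 hρd hρ2 hρ1 h2, hv.angle₂]
  · intro z
    rw [hA₃', toDisc_reflection_mul hτd hτ3 hτ1 hσd hσ3 hσ2 h3, hv.angle₃]
  · intro z
    rw [hA₁', hA₂', hA₃', ← mul_smul ρ ρ, hρρ, one_smul, ← mul_smul σ σ, hσσ, one_smul,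
      ← mul_smul τ τ, hττ, one_smul]
  · rw [hA₂', hσ3, toDisc_reflection hρd hρ1 hρ2 (hne h1).2.2]

/-- The relation `ρ₁ ρ₂ ρ₃ = c` in the centrally extended triangle group. -/
lemma labeledRot_mul_mul {p q r : ℕ} (hp : 1 < p) (hq : 0 < q) (hr : 0 < r)
    (hyp : 1 / (p : ℝ) + 1 / (q : ℝ) + 1 / (r : ℝ) < 1) {v₁ v₂ v₃ : ℍ}
    (hv₁ : orientedAngle v₁ v₂ v₃ = Real.pi / p) {A₁ A₂ A₃ : SL(2, ℝ)}
    (h₁ : ∀ z, toDisc v₁ (A₁ • z) =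
      Complex.exp (Complex.I * (2 * (Real.pi / p) : ℝ)) * toDisc v₁ z)
    (h₂ : ∀ z, toDisc v₂ (A₂ • z) =
      Complex.exp (Complex.I * (2 * (Real.pi / q) : ℝ)) * toDisc v₂ z)
    (h₃ : ∀ z, toDisc v₃ (A₃ • z) =
      Complex.exp (Complex.I * (2 * (Real.pi / r) : ℝ)) * toDisc v₃ z)
    (hid : ∀ z : ℍ, A₁ • A₂ • A₃ • z = z) (h12 : toDisc v₁ v₂ ≠ 0)
    (hrefl : toDisc v₁ (A₂ • v₃) =
      toDisc v₁ v₂ / (starRingEnd ℂ) (toDisc v₁ v₂) * (starRingEnd ℂ) (toDisc v₁ v₃)) :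
    labeledRot v₁ A₁ (2 * (Real.pi / p)) * labeledRot v₂ A₂ (2 * (Real.pi / q)) *
      labeledRot v₃ A₃ (2 * (Real.pi / r)) = shift (2 * Real.pi) := by
  have hπ := Real.pi_pos
  have hp' : (1 : ℝ) < p := by exact_mod_cast hp
  have hq' : (0 : ℝ) < q := by exact_mod_cast hq
  have hr' : (0 : ℝ) < r := by exact_mod_cast hr
  obtain ⟨k, hk⟩ := ((((isLabel_rotLabel h₁).comp (isLabel_rotLabel h₂)).comp
    (isLabel_rotLabel h₃))).exists_eq (by simpa [mul_smul] using hid)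
  have hfix : A₃ • v₃ = v₃ := smul_center h₃
  have hback : A₁ • A₂ • v₃ = v₃ := by
    have := hid v₃
    rwa [hfix] at this
  obtain ⟨η, hη0, hη1, hη⟩ := logSub_reflection h12 hrefl (by rw [hv₁]; positivity)
    (by rw [hv₁, div_lt_iff₀ (by linarith)]; nlinarith)
  -- The product acts trivially, so its label is a constant `2 π k`, computed at `v₃`. There the
  -- third rotation contributes only its angle, and the logarithmic terms of the other two combine
  -- to `η`.
  have hsum : 2 * (Real.pi / p) + 2 * (Real.pi / q) + 2 * (Real.pi / r) + η =
      2 * Real.pi * k := by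
    have h4 := hk v₃
    simp only [rotLabel, hfix, hback] at h4
    have h5 : ((2 * (Real.pi / p) + 2 * (Real.pi / q) + 2 * (Real.pi / r) + η : ℝ) : ℂ) =
        ((2 * Real.pi * k : ℝ) : ℂ) := by
      push_cast at h4 ⊢
      rw [← hη, ← h4]
      ring
    exact_mod_cast h5
  -- The angle sum and `η` both lie strictly between `0` and `2 π`, so `0 < k < 2`.
  have hk1 : k = 1 := by
    have e : 2 * (Real.pi / p) + 2 * (Real.pi / q) + 2 * (Real.pi / r) =
        2 * Real.pi * (1 / (p : ℝ) + 1 / (q : ℝ) + 1 / (r : ℝ)) := by ring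
    have hpos : 0 < 1 / (p : ℝ) + 1 / (q : ℝ) + 1 / (r : ℝ) := by positivity
    rw [e] at hsum
    have h6 : (0 : ℝ) < k := by
      by_contra hle
      push Not at hle
      nlinarith [mul_pos hπ hpos, mul_nonneg hπ.le (sub_nonneg.2 hle)]
    have h7 : (k : ℝ) < 2 := by
      by_contra hle
      push Not at hle
      nlinarith [mul_lt_mul_of_pos_left hyp hπ, mul_nonneg hπ.le (sub_nonneg.2 hle)]
    have h8 : 0 < k := by exact_mod_cast h6
    have h9 : k < 2 := by exact_mod_cast h7
    omega
  ext1 ⟨z, w⟩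
  rw [Equiv.Perm.mul_apply, Equiv.Perm.mul_apply, shift_apply]
  simp only [labeledRot, labelPerm_apply, hid]
  have := hk z
  rw [hk1] at this
  rw [← mul_one (2 * (Real.pi : ℂ)), ← Int.cast_one, ← this]
  congr 1
  ring

/-- The stabilizer in `Π` of the fibre over `v₁` contains the translation by `2 π q r / s`. -/
lemma exists_mem_piGroup {p q r : ℕ} (hp : 1 < p) (hq : 0 < q) (hr : 0 < r)
    (hyp : 1 / (p : ℝ) + 1 / (q : ℝ) + 1 / (r : ℝ) < 1) {v₁ v₂ v₃ : ℍ}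
    (hv : IsTriangle p q r v₁ v₂ v₃) :
    ∃ g ∈ piGroup v₁ v₂ v₃, ∀ w, g (v₁, w) =
      (v₁, w + (2 * Real.pi * (q * r * (1 - 1 / p - 1 / q - 1 / r)) : ℝ)) := by
  have hp0 : 0 < p := by omega
  obtain ⟨A₁, hA₁, A₂, hA₂, A₃, hA₃, h₁, h₂, h₃, hid, h12, hrefl⟩ := exists_rotations hp0 hq hr hv
  have hrel := labeledRot_mul_mul hp hq hr hyp hv.angle₁ h₁ h₂ h₃ hid h12 hrefl
  have e₁ := labeledRot_pow_eq hp0 h₁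
  have e₂ := labeledRot_pow_eq hq h₂
  have e₃ := labeledRot_pow_eq hr h₃
  set G := extendedTriangleGroup v₁ v₂ v₃ with hG
  have m₁ : labeledRot v₁ A₁ (2 * (Real.pi / p)) ∈ G := labeledRot_mem hA₁ h₁
  have m₂ : labeledRot v₂ A₂ (2 * (Real.pi / q)) ∈ G := labeledRot_mem hA₂ h₂
  have m₃ : labeledRot v₃ A₃ (2 * (Real.pi / r)) ∈ G := labeledRot_mem hA₃ h₃
  have mc : shift (2 * Real.pi) ∈ G := by rw [← e₁]; exact pow_mem m₁ p
  have hcomm := mem_commutator_of_relations (G := G) (x₁ := ⟨_, m₁⟩) (x₂ := ⟨_, m₂⟩)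
    (x₃ := ⟨_, m₃⟩) (c := ⟨_, mc⟩) (q := q) (r := r) (Subtype.ext e₂) (Subtype.ext e₃)
    (Subtype.ext hrel)
  -- Passes from the commutator of the abstract group `G` to `⁅G, G⁆` inside the permutations, which
  -- is `Π`.
  have hmem := Subgroup.mem_map_of_mem G.subtype hcomm
  rw [Subgroup.map_subtype_commutator] at hmem
  refine ⟨_, hmem, fun w => ?_⟩
  have hp' : (p : ℂ) ≠ 0 := by exact_mod_cast hp0.ne'
  have hq' : (q : ℂ) ≠ 0 := by exact_mod_cast hq.ne'
  have hr' : (r : ℂ) ≠ 0 := by exact_mod_cast hr.ne'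
  -- On the fibre over `v₁` the labeled rotation is translation by its angle, so all factors act by
  -- translations that simply add up.
  have hinv : (labeledRot v₁ A₁ (2 * (Real.pi / p)) ^ (q * r) * shift (2 * Real.pi) ^ r *
      shift (2 * Real.pi) ^ q)⁻¹ (v₁, w) =
      (v₁, w - (q * r * (2 * (Real.pi / p)) + r * (2 * Real.pi) + q * (2 * Real.pi))) := by
    rw [Equiv.Perm.inv_eq_iff_eq, Equiv.Perm.mul_apply, Equiv.Perm.mul_apply, shift_pow,
      shift_pow, shift_apply, shift_apply, labeledRot_pow_apply_center (smul_center h₁)]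
    congr 1
    push_cast
    ring
  simp only [Subgroup.coe_subtype, Subgroup.coe_mul, Subgroup.coe_inv, Subgroup.coe_pow]
  rw [Equiv.Perm.mul_apply, hinv, shift_pow, shift_apply]
  congr 1
  push_cast
  field_simp
  ring

/-! ## The fibre over a zero of `F` as a Reeb orbit -/

section

variable {Γ : Subgroup (Equiv.Perm (ℍ × ℂ))} {α : E → E →L[ℝ] ℝ} {v : ℍ} {T : ℝ}

lemma isReebTrajectory_fibre (hα : ∀ t : ℝ, IsReebVector α (coord (v, t)) (0, 1)) :
    IsReebTrajectory α fun t => (v, t) := fun t =>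
  ⟨(0, 1), hα t, (hasDerivAt_const t (v : ℂ)).prodMk (hasDerivAt_id t)⟩

lemma isReebLift_fibre (hα : ∀ t : ℝ, IsReebVector α (coord (v, t)) (0, 1)) :
    IsReebLift Γ α (fibre Γ v) fun t => (v, t) :=
  ⟨isReebTrajectory_fibre hα, fun _ => rfl⟩

lemma apply_unitTangent_fibre {g : Equiv.Perm (ℍ × ℂ)}
    (hgT : ∀ w, g (v, w) = (v, w + T)) (t : ℝ) :
    g (unitTangent (v, t)) = unitTangent (v, t + T) := by
  simp only [unitTangent]
  rw [hgT]
  congr 1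
  push_cast
  ring

lemma isReebOrbit_fibre (hα : ∀ t : ℝ, IsReebVector α (coord (v, t)) (0, 1)) (hT : 0 < T)
    {g : Equiv.Perm (ℍ × ℂ)} (hg : g ∈ Γ) (hgT : ∀ w, g (v, w) = (v, w + T)) :
    IsReebOrbit Γ α (fibre Γ v) T where
  pos := hT
  periodic := by
    intro t
    refine Quotient.sound ?_
    change unitTangent (v, t + T) ∈ MulAction.orbit Γ (unitTangent (v, t))
    exact ⟨⟨g, hg⟩, apply_unitTangent_fibre hgT t⟩
  reeb := ⟨_, isReebLift_fibre hα⟩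

lemma exists_pow_mem {T₀ : ℝ} (h : ∃ g ∈ Γ, ∀ w, g (v, w) = (v, w + T₀)) (n : ℕ) :
    ∃ g ∈ Γ, ∀ w, g (v, w) = (v, w + (n * T₀ : ℝ)) := by
  obtain ⟨g, hg, hgT⟩ := h
  refine ⟨g ^ n, pow_mem hg n, fun w => ?_⟩
  induction n with
  | zero => simp
  | succ n ih =>
    rw [pow_succ', Equiv.Perm.mul_apply, ih, hgT]
    congr 1
    push_cast
    ring

end

/-! ## The linearized return map -/

lemma stdForm_linFlow (v : ℍ) (w t s : ℝ) (u : E) :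
    stdForm (coord (v, s)) (linFlow v.im w t u) = stdForm (coord (v, s)) u := by
  rw [stdForm_apply, stdForm_apply, linFlow_apply, Complex.sub_re]
  simp only [coord, coe_im]
  ring

/-- Relative to the frame, which turns by `t` along the fibre, the horizontal rotation by `-w t`
becomes rotation by `-(1 + w) t`. The vertical components agree because `linFlow` preserves `λ`. -/
lemma linFlow_frame (v : ℍ) (w t : ℝ) (j : Fin 2) :
    linFlow v.im w t (frame j (coord (v, 0))) =
      ∑ i, rot (-((1 + w) * t)) i j • frame i (coord (v, t)) := by
  have hy := v.im_pos.ne'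
  have e1 : Complex.exp (-(Complex.I * w * t)) = ⟨Real.cos (w * t), -Real.sin (w * t)⟩ := by
    have h : -(Complex.I * w * t) = ((-(w * t) : ℝ) : ℂ) * Complex.I := by push_cast; ring
    rw [h, Complex.exp_mul_I, ← Complex.ofReal_cos, ← Complex.ofReal_sin, Real.cos_neg,
      Real.sin_neg]
    apply Complex.ext
    · rw [Complex.add_re, Complex.ofReal_re, Complex.re_ofReal_mul]
      simp
    · rw [Complex.add_im, Complex.ofReal_im, Complex.im_ofReal_mul]
      simp
  have hc : Real.cos ((1 + w) * t) = Real.cos t * Real.cos (w * t) - Real.sin t * Real.sin (w * t)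
      := by rw [add_mul, one_mul, Real.cos_add]
  have hs : Real.sin ((1 + w) * t) = Real.sin t * Real.cos (w * t) + Real.cos t * Real.sin (w * t)
      := by rw [add_mul, one_mul, Real.sin_add]
  have h1 := Real.cos_sq_add_sin_sq t
  rw [linFlow_apply, e1, Fin.sum_univ_two]
  clear e1
  fin_cases j
  · simp only [rot, frame, coord, coe_im, Fin.zero_eta, Matrix.cons_val_zero,
      Matrix.cons_val_one, Matrix.of_apply, Matrix.cons_val', Matrix.cons_val_fin_one,
      Real.cos_zero, Real.sin_zero, Real.cos_neg, Real.sin_neg, hc, hs]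
    clear hc hs
    generalize Real.cos (w * t) = cw at *
    generalize Real.sin (w * t) = sw at *
    generalize Real.cos t = ct at *
    generalize Real.sin t = st at *
    refine Prod.ext (Complex.ext ?_ ?_) ?_
    · simp
      linear_combination (-(v.im * cw)) * h1
    · simp
      linear_combination (v.im * sw) * h1
    · simp
      field_simp
      linear_combination cw * h1
  · simp only [rot, frame, coord, coe_im, Fin.mk_one, Matrix.cons_val_zero,
      Matrix.cons_val_one, Matrix.of_apply, Matrix.cons_val', Matrix.cons_val_fin_one,
      Real.cos_zero, Real.sin_zero, Real.cos_neg, Real.sin_neg, hc, hs]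
    clear hc hs
    generalize Real.cos (w * t) = cw at *
    generalize Real.sin (w * t) = sw at *
    generalize Real.cos t = ct at *
    generalize Real.sin t = st at *
    refine Prod.ext (Complex.ext ?_ ?_) ?_
    · simp
      linear_combination (-(v.im * sw)) * h1
    · simp
      linear_combination (-(v.im * cw)) * h1
    · simp
      field_simp
      linear_combination sw * h1

section

variable {Γ : Subgroup (Equiv.Perm (ℍ × ℂ))} {f : ℂ → ℝ} {v : ℍ} {w T : ℝ}

lemma mem_contactPlane_iff (hf : f v ≠ 0) (u : E) :
    u ∈ contactPlane (scaledForm f) (coord (v, 0)) ↔ stdForm (coord (v, 0)) u = 0 := by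
  rw [LinearMap.mem_ker]
  change f v * stdForm (coord (v, 0)) u = 0 ↔ _
  rw [mul_eq_zero, or_iff_right hf]

/-- The linearized return map: the rotation by the angle `-(1 + w) T`, where `w` is the rotation
speed. -/
def returnMap (hf : f v ≠ 0) (w T : ℝ) :
    Module.End ℝ (contactPlane (scaledForm f) (coord (v, 0))) :=
  (linFlow v.im (1 + w) T : E →ₗ[ℝ] E).restrict fun u hu => by
    rw [mem_contactPlane_iff hf] at hu ⊢
    rw [← hu]
    exact stdForm_linFlow v (1 + w) T 0 u

lemma coe_returnMap (hf : f v ≠ 0) (u : contactPlane (scaledForm f) (coord (v, 0))) :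
    (returnMap hf w T u : E) = linFlow v.im (1 + w) T u := rfl

/-- The deck transformation has label `T` at `v`, so its horizontal derivative there is `e^(iT)`.
Undoing it after the flow's `e^(-iwT)` leaves `e^(-i(1+w)T)`. The vertical component is recovered
from invariance of `λ`. -/
lemma isLinearizedReturn_returnMap (hΓ : Γ ≤ SLTilde) (hf : f v ≠ 0)
    (hflow : IsLinearizedFlow (scaledForm f) (coord (v, 0)) T (linFlow v.im w))
    {g : Equiv.Perm (ℍ × ℂ)} (hg : g ∈ Γ) (hgT : ∀ w, g (v, w) = (v, w + T)) :
    IsLinearizedReturn Γ (scaledForm f) (fun t => (v, t)) T (returnMap hf w T) := by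
  obtain ⟨A, -, ℓ, hl, hgA⟩ := mem_labeledLift_iff.1 (hΓ hg)
  have h0 := hgT 0
  rw [hgA, zero_add, zero_add, Prod.mk.injEq] at h0
  refine ⟨_, hflow, g, hg, ?_, fun u => ?_⟩
  · simpa using apply_unitTangent_fibre hgT 0
  · rw [(hasFDerivAt_actCoord hl hgA v 0).fderiv, coe_returnMap]
    have h1 : (actDeriv A v (linFlow v.im (1 + w) T u)).1 = (linFlow v.im w T u).1 := by
      rw [actDeriv_apply, ← hl.exp_eq, h0.2, linFlow_apply, linFlow_apply]
      simp only
      rw [← mul_assoc, ← Complex.exp_add]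
      congr 2
      push_cast
      ring
    refine Prod.ext h1 ?_
    have h2 := stdForm_actDeriv A v 0 0 (linFlow v.im (1 + w) T u)
    rw [stdForm_linFlow, ← stdForm_linFlow v w T, h0.1, stdForm_apply, stdForm_apply, h1] at h2
    linarith

/-- The contact plane is identified with `ℂ` by the projection to the horizontal coordinate. -/
def contactPlaneEquiv (hf : f v ≠ 0) :
    contactPlane (scaledForm f) (coord (v, 0)) ≃ₗ[ℝ] ℂ where
  toFun u := (u : E).1
  invFun z := ⟨(z, -(1 / v.im * z.re)), by
    rw [mem_contactPlane_iff hf, stdForm_apply]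
    simp [coord]⟩
  map_add' _ _ := rfl
  map_smul' _ _ := rfl
  left_inv u := by
    have h := (mem_contactPlane_iff hf _).1 u.2
    rw [stdForm_apply] at h
    simp only [coord, coe_im] at h
    refine Subtype.ext (Prod.ext rfl ?_)
    simp only
    linarith
  right_inv _ := rfl

lemma conj_returnMap (hf : f v ≠ 0) :
    (contactPlaneEquiv hf).conj (returnMap hf w T) =
      Algebra.lmul ℝ ℂ (Complex.exp (-(Complex.I * (1 + w : ℝ) * T))) := by
  ext1 z
  rfl

/-- The real characteristic polynomial of multiplication by `c` has roots `c` and `conj c`. -/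
lemma charpoly_lmul_root {c μ : ℂ}
    (h : ((Algebra.lmul ℝ ℂ c).charpoly.map (algebraMap ℝ ℂ)).IsRoot μ) :
    ‖μ‖ = ‖c‖ := by
  rw [← LinearMap.charpoly_toMatrix _ Complex.basisOneI] at h
  have h1 : LinearMap.toMatrix Complex.basisOneI Complex.basisOneI (Algebra.lmul ℝ ℂ c) =
      !![c.re, -c.im; c.im, c.re] := Algebra.leftMulMatrix_complex c
  rw [h1, Matrix.charpoly_fin_two, Polynomial.IsRoot] at h
  simp [Matrix.trace_fin_two, Matrix.det_fin_two] at h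
  have h2 : (μ - c) * (μ - (starRingEnd ℂ) c) = 0 := by
    have h3 : (c.re : ℂ) + c.re = c + (starRingEnd ℂ) c := by
      apply Complex.ext <;> simp
    have h4 : (c.re : ℂ) * c.re + c.im * c.im = c * (starRingEnd ℂ) c := by
      rw [Complex.mul_conj, Complex.normSq_apply]
      push_cast
      ring
    linear_combination h + μ * h3 - h4
  rcases mul_eq_zero.1 h2 with h3 | h3
  · rw [sub_eq_zero.1 h3]
  · rw [sub_eq_zero.1 h3, Complex.norm_conj]

lemma returnMap_charpoly_root (hf : f v ≠ 0) {μ : ℂ}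
    (h : ((returnMap hf w T).charpoly.map (algebraMap ℝ ℂ)).IsRoot μ) : ‖μ‖ = 1 := by
  rw [← LinearEquiv.charpoly_conj (contactPlaneEquiv hf), conj_returnMap] at h
  rw [charpoly_lmul_root h, Complex.norm_exp]
  simp

lemma not_hasEigenvalue_returnMap (hf : f v ≠ 0)
    (hT : ∀ m : ℤ, (1 + w) * T ≠ 2 * Real.pi * m) :
    ¬ Module.End.HasEigenvalue (returnMap hf w T) 1 := by
  intro h
  obtain ⟨u, hu⟩ := h.exists_hasEigenvector
  have h1 := congrArg (contactPlaneEquiv hf) hu.apply_eq_smul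
  have h2 : Complex.exp (-(Complex.I * (1 + w : ℝ) * T)) * contactPlaneEquiv hf u =
      contactPlaneEquiv hf u := by
    rw [one_smul] at h1
    exact h1
  have h3 : contactPlaneEquiv hf u ≠ 0 := by simpa using hu.2
  have h4 := (mul_eq_right₀ h3).1 h2
  obtain ⟨m, hm⟩ := Complex.exp_eq_one_iff.1 h4
  apply hT (-m)
  have h5 : (((1 + w) * T : ℝ) : ℂ) = ((2 * Real.pi * (-m : ℤ) : ℝ) : ℂ) := by
    apply mul_left_cancel₀ Complex.I_ne_zero
    push_cast at hm ⊢
    linear_combination -hm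
  exact_mod_cast h5

end

/-! ## The Conley–Zehnder index -/

/-- The path already consists of rotations, so the constant homotopy works. The strict bounds say
that the number of turns `(1 + w) X` is not an integer. -/
lemma isCZIndexOfPath_rot {w X T : ℝ} (hT : T = 2 * Real.pi * X) {k : ℤ}
    (hk : (k : ℝ) < (1 + w) * X) (hk' : (1 + w) * X < k + 1) :
    IsCZIndexOfPath (fun t => rot (-((1 + w) * t))) T (-2 * k - 1) := by
  have hπ := Real.pi_pos
  constructor
  · intro h
    have h1 : (rot (-((1 + w) * T)) - 1).det = 2 - 2 * Real.cos ((1 + w) * T) := by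
      rw [Matrix.det_fin_two]
      simp [rot]
      linear_combination Real.cos_sq_add_sin_sq ((1 + w) * T)
    simp only [h1] at h
    obtain ⟨m, hm⟩ := (Real.cos_eq_one_iff ((1 + w) * T)).1 (by linarith)
    rw [hT] at hm
    have h2 : (m : ℝ) = (1 + w) * X := by
      apply mul_right_cancel₀ (b := 2 * Real.pi) (by positivity)
      rw [hm]
      ring
    rw [← h2] at hk hk'
    have h3 : k < m := by exact_mod_cast hk
    have h4 : m < k + 1 := by exact_mod_cast hk'
    omega
  · left
    refine ⟨fun _ _ => 1, fun t => -((1 + w) * t) / (2 * Real.pi), ?_, ?_, ?_, ?_, ?_, ?_, ?_⟩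
    · exact continuousOn_const
    · intro u _
      refine ⟨fun t _ => ?_, rfl⟩
      rw [Matrix.det_one]
      exact one_pos
    · intro t _
      rfl
    · exact Continuous.continuousOn (by fun_prop)
    · simp
    · intro t _
      have h1 : 2 * Real.pi * (-((1 + w) * t) / (2 * Real.pi)) = -((1 + w) * t) := by
        field_simp
      simp only [h1, one_mul, mul_one]
    · have h1 : -((1 + w) * T) / (2 * Real.pi) = -((1 + w) * X) := by
        rw [hT]
        field_simp
      -- Negation turns the open interval `(k, k + 1)` into `(-k - 1, -k)`, whence `2 (-k - 1) + 1 =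
      -- -2 k - 1`.
      have h2 : ⌊-((1 + w) * X)⌋ = -k - 1 := by
        rw [Int.floor_eq_iff]
        push_cast
        constructor <;> linarith
      simp only [h1, h2]
      ring

/-- The upper bounds are finitely many open conditions that hold at `ε = 0`, which is where `N`
enters. The lower bound is strict for every `ε > 0`, even when `n * x` is an integer. -/
lemma exists_small_rotation {κ x : ℝ} (hκ : 0 < κ) (hx : 0 < x) (N : ℕ) :
    ∃ ε₀ : ℝ, 0 < ε₀ ∧ ∀ ε : ℝ, 0 < ε → ε < ε₀ → ∀ n : ℕ, 1 ≤ n → n ≤ N →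
      (⌊n * x⌋ : ℝ) < (1 + ε * κ) * (n * x) ∧ (1 + ε * κ) * (n * x) < ⌊n * x⌋ + 1 := by
  have h : ∀ᶠ ε : ℝ in 𝓝[>] 0, ∀ n ∈ Finset.Icc 1 N,
      (1 + ε * κ) * (n * x) < ⌊n * x⌋ + 1 := by
    rw [Filter.eventually_all_finset]
    intro n _
    have ht : Filter.Tendsto (fun ε : ℝ => (1 + ε * κ) * (n * x)) (𝓝[>] 0)
        (𝓝 ((1 + 0 * κ) * (n * x))) :=
      (Continuous.tendsto (by fun_prop) 0).mono_left nhdsWithin_le_nhds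
    refine ht.eventually_lt_const ?_
    rw [zero_mul, add_zero, one_mul]
    exact Int.lt_floor_add_one _
  obtain ⟨ε₀, hε₀, hsub⟩ := mem_nhdsGT_iff_exists_Ioo_subset.1 h
  refine ⟨ε₀, hε₀, fun ε h0 h1 n hn hnN => ⟨?_, hsub ⟨h0, h1⟩ n (Finset.mem_Icc.2 ⟨hn, hnN⟩)⟩⟩
  refine (Int.floor_le _).trans_lt ?_
  have h2 : (0 : ℝ) < n := by exact_mod_cast hn
  have : 0 < ε * κ * (n * x) := by positivity
  linarith

lemma sNum_cast (p q r : ℕ) :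
    ((sNum p q r : ℚ) : ℝ) = (1 - 1 / (p : ℝ) - 1 / (q : ℝ) - 1 / (r : ℝ))⁻¹ := by
  simp [sNum]

end Brieskorn

end

/-! ### Assembly of the theorem -/

theorem proposition4p2 (p q r : ℕ) (hp : 0 < p) (hq : 0 < q) (hr : 0 < r)
    (hpq : Nat.Coprime p q) (hqr : Nat.Coprime q r) (hpr : Nat.Coprime p r)
    (hyp : 1 / (p : ℚ) + 1 / (q : ℚ) + 1 / (r : ℚ) < 1)
    (v₁ v₂ v₃ : ℍ) (hv : Brieskorn.IsTriangle p q r v₁ v₂ v₃)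
    (F : ℍ → ℂ)
    (hF : Brieskorn.IsAutomorphicForm (Brieskorn.piGroup v₁ v₂ v₃) (Brieskorn.sNum p q r / p) F)
    (hzero : ∀ A ∈ Brieskorn.triangleGroup v₁ v₂ v₃, Brieskorn.HasSimpleZero F (A • v₁))
    (N : ℕ) (hN : 0 < N) :
    ∃ ε₀ : ℝ, 0 < ε₀ ∧ ∀ ε : ℝ, 0 < ε → ε < ε₀ →
      Brieskorn.IsContactForm (Brieskorn.piGroup v₁ v₂ v₃)
        (Brieskorn.perturbedForm (Brieskorn.sNum p q r / p) F ε) ∧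
      Brieskorn.IsReebOrbit (Brieskorn.piGroup v₁ v₂ v₃)
        (Brieskorn.perturbedForm (Brieskorn.sNum p q r / p) F ε)
        (Brieskorn.fibre (Brieskorn.piGroup v₁ v₂ v₃) v₁)
        (2 * Real.pi * (q * r / (Brieskorn.sNum p q r : ℝ))) ∧
      ∀ n : ℕ, 1 ≤ n → n ≤ N →
        Brieskorn.IsReebOrbit (Brieskorn.piGroup v₁ v₂ v₃)
          (Brieskorn.perturbedForm (Brieskorn.sNum p q r / p) F ε)
          (Brieskorn.fibre (Brieskorn.piGroup v₁ v₂ v₃) v₁)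
          (n * (2 * Real.pi * (q * r / (Brieskorn.sNum p q r : ℝ)))) ∧
        Brieskorn.IsNondegenerate (Brieskorn.piGroup v₁ v₂ v₃)
          (Brieskorn.perturbedForm (Brieskorn.sNum p q r / p) F ε)
          (Brieskorn.fibre (Brieskorn.piGroup v₁ v₂ v₃) v₁)
          (n * (2 * Real.pi * (q * r / (Brieskorn.sNum p q r : ℝ)))) ∧
        Brieskorn.IsElliptic (Brieskorn.piGroup v₁ v₂ v₃)
          (Brieskorn.perturbedForm (Brieskorn.sNum p q r / p) F ε)
          (Brieskorn.fibre (Brieskorn.piGroup v₁ v₂ v₃) v₁)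
          (n * (2 * Real.pi * (q * r / (Brieskorn.sNum p q r : ℝ)))) ∧
        Brieskorn.HasCZIndex (Brieskorn.piGroup v₁ v₂ v₃)
          (Brieskorn.perturbedForm (Brieskorn.sNum p q r / p) F ε)
          Brieskorn.frame
          (Brieskorn.fibre (Brieskorn.piGroup v₁ v₂ v₃) v₁)
          (n * (2 * Real.pi * (q * r / (Brieskorn.sNum p q r : ℝ))))
          (-2 * ⌊(n : ℚ) * (q * r / Brieskorn.sNum p q r)⌋ - 1) := by
  open Brieskorn in
  have hypR : 1 / (p : ℝ) + 1 / (q : ℝ) + 1 / (r : ℝ) < 1 := by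
    have h := (Rat.cast_lt (K := ℝ)).2 hyp
    push_cast at h
    exact h
  -- Needed so that the angle `π / p` is less than `π` in the computation of `η`.
  have hp1 : 1 < p := by
    have hq' : (0 : ℝ) < 1 / q := by positivity
    have hr' : (0 : ℝ) < 1 / r := by positivity
    have hp' : 1 / (p : ℝ) < 1 := by linarith
    rw [div_lt_one (by exact_mod_cast hp)] at hp'
    exact_mod_cast hp'
  set Γ := piGroup v₁ v₂ v₃ with hΓdef
  have hΓ : Γ ≤ SLTilde := piGroup_le v₁ v₂ v₃
  set a := sNum p q r / p with ha
  set X := (q * r / (sNum p q r : ℝ)) with hX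
  have hXeq : X = q * r * (1 - 1 / p - 1 / q - 1 / r) := by
    rw [hX, sNum_cast, div_inv_eq_mul]
  have hXpos : 0 < X := by
    rw [hXeq]
    have : (0 : ℝ) < 1 - 1 / p - 1 / q - 1 / r := by linarith
    positivity
  have hπ := Real.pi_pos
  have hT : 0 < 2 * Real.pi * X := by positivity
  have hgen : ∃ g ∈ Γ, ∀ w, g (v₁, w) = (v₁, w + (2 * Real.pi * X : ℝ)) := by
    rw [hXeq]
    exact exists_mem_piGroup hp1 hq hr hypR hv
  have hz := hzero 1 (one_mem _)
  rw [one_smul] at hz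
  have hd : DifferentiableOn ℂ (F ∘ ofComplex) halfPlane := hF.holomorphic
  -- Simplicity of the zero enters here: `F'(v₁) ≠ 0` makes the rotation speed positive.
  have hκ : 0 < rotSpeed a F v₁ := by
    have h1 := v₁.im_pos
    have h2 := norm_pos_iff.2 hz.2
    unfold rotSpeed
    positivity
  obtain ⟨ε₀, hε₀, hsmall⟩ := exists_small_rotation hκ hXpos N
  refine ⟨ε₀, hε₀, fun ε hε hεε₀ => ?_⟩
  set f : ℂ → ℝ := fun z => 1 + ε * normSq a F z with hf
  have hform : perturbedForm a F ε = scaledForm f := perturbedForm_eq a F ε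
  have hfsm : ContDiffOn ℝ ∞ f halfPlane :=
    contDiffOn_const.add (contDiffOn_const.mul (contDiffOn_normSq hd))
  have hfpos : ∀ z : ℍ, 0 < f z := fun z => one_add_normSq_pos hε.le z
  have hreeb : ∀ t : ℝ, IsReebVector (perturbedForm a F ε) (coord (v₁, t)) (0, 1) := fun t => by
    rw [← reebField_of_zero (a := a) (ε := ε) hz.1]
    exact isReebVector_reebField hd hε.le v₁ t
  have horbit : ∀ n : ℕ, 1 ≤ n →
      IsReebOrbit Γ (perturbedForm a F ε) (fibre Γ v₁) (n * (2 * Real.pi * X)) := by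
    intro n hn
    obtain ⟨g, hg, hgT⟩ := exists_pow_mem hgen n
    have hn' : (0 : ℝ) < n := by exact_mod_cast hn
    exact isReebOrbit_fibre hreeb (by positivity) hg hgT
  refine ⟨?_, by simpa using horbit 1 le_rfl, fun n hn hnN => ⟨horbit n hn, ?_⟩⟩
  · rw [hform]
    refine isContactForm_scaledForm hΓ hfsm hfpos fun g hg x => ?_
    simp only [hf]
    rw [normSq_invariant hΓ hF hg]
  obtain ⟨hlow, hhigh⟩ := hsmall ε hε hεε₀ n hn hnN
  set w := ε * rotSpeed a F v₁ with hw
  have hT0 : (0 : ℝ) ≤ n * (2 * Real.pi * X) := by positivity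
  have hTeq : (n : ℝ) * (2 * Real.pi * X) = 2 * Real.pi * (n * X) := by ring
  have hflow : IsLinearizedFlow (perturbedForm a F ε) (coord (v₁, 0)) (n * (2 * Real.pi * X))
      (linFlow v₁.im w) :=
    isLinearizedFlow_linFlow (contDiffOn_reebField hd hε.le).1
      (isReebVector_reebField hd hε.le) (reebField_of_zero hz.1)
      (hasFDerivAt_reebField hd hε.le hz.1) hT0
  obtain ⟨g, hg, hgT⟩ := exists_pow_mem hgen n
  have hlift := isReebLift_fibre (Γ := Γ) hreeb
  have hnonint : ∀ m : ℤ, (1 + w) * (n * (2 * Real.pi * X)) ≠ 2 * Real.pi * m := by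
    intro m hm
    have h2 : (m : ℝ) = (1 + w) * (n * X) := by
      apply mul_left_cancel₀ (a := 2 * Real.pi) (by positivity)
      rw [← hm]
      ring
    rw [← h2] at hlow hhigh
    have h3 : ⌊n * X⌋ < m := by exact_mod_cast hlow
    have h4 : m < ⌊n * X⌋ + 1 := by exact_mod_cast hhigh
    omega
  -- The index is stated with a rational floor, the dynamics use the real one.
  have hfloor : ⌊(n : ℚ) * (q * r / sNum p q r)⌋ = ⌊n * X⌋ := by
    rw [hX, ← Rat.floor_cast (α := ℝ)]
    push_cast
    rfl
  rw [hfloor]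
  rw [hform] at hflow hlift ⊢
  have hret := isLinearizedReturn_returnMap hΓ (hfpos v₁).ne' hflow hg hgT
  refine ⟨⟨_, hlift, _, hret, not_hasEigenvalue_returnMap _ hnonint⟩,
    ⟨_, hlift, _, hret, fun μ hμ => returnMap_charpoly_root _ hμ⟩,
    isTrivialization_frame hΓ hfsm hfpos, _, hlift, _, hflow,
    fun t => rot (-((1 + w) * t)), fun t _ j => linFlow_frame v₁ w t j,
    isCZIndexOfPath_rot hTeq hlow hhigh⟩
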